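/- Fix $\alpha>2$, $\lambda_s, r_p, p_p, p_s, \rho>0$ and $\sigma^2,\tau\ge 0$. A primary receiver is at the origin of the plane and its transmitter is at distance $r_p$ on the positive $x$-axis. Secondary transmitters are located at the points $X_i=x_i\angle\theta_i$, $i\in\mathbb N$, of a homogeneous Poisson point process of density $\lambda_s$ in the plane. They carry i.i.d. link orientations $\omega_i$ uniform on $[0,2\pi)$ and i.i.d. fading coefficients $G_i\sim\exp(1)$. The primary link has fading coefficient $H\sim\exp(1)$. The point process, the sequences $(\omega_i)$ and $(G_i)$, and $H$ are mutually independent. For $j\in\{pt,pr,st\}$ (primary transmitter, primary receiver, secondary transmitter) let $g_j$ be the sectorized beam pattern with beamwidth $\phi_j\in[0,2\pi]$, main lobe gain $a_j>0$ and side lobe gain $b_j\ge 0$: $g_j$ is $2\pi$-periodic and, for $|\theta|\le\pi$, $g_j(\theta)=a_j$ if $|\theta|\le\phi_j/2$ and $g_j(\theta)=b_j$ otherwise. Put $q_j=\phi_j/(2\pi)$. The power received at the primary receiver from the $i$-th secondary transmitter is $$P_i=p_s\,G_i\,g_{pr}(\theta_i)\,g_{st}(\theta_i-\pi-\omega_i)\,x_i^{-\alpha},$$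 and this transmitter is active if and only if $P_i<\rho$. The primary coverage is $$p_{cp}(\tau,\rho)=\mathbb P\left[\frac{H\,p_p\,g_{pt}(0)\,g_{pr}(0)\,r_p^{-\alpha}}{\sigma^2+\sum_i P_i\,\mathbf 1(P_i<\rho)}>\tau\right].$$ Then $$p_{cp}(\tau,\rho)=\exp\left(-\frac{\sigma^2\kappa_p\tau}{\rho}-\frac{\lambda_s}{\alpha}\,\frac{p_s^{2/\alpha}}{\rho^{2/\alpha}}\left(\kappa_p^{2/\alpha}\tau^{2/\alpha}\,\pi\csc\frac{2\pi}{\alpha}-\Gamma\left(\tfrac{2}{\alpha}\right)+\int_{\kappa_p\tau}^{\infty}\frac{e^{-u}}{u\,(u-\kappa_p\tau)^{-2/\alpha}}\,du\right)n_3\right),$$ where $\kappa_p=\rho\,r_p^{\alpha}/(p_p\,a_{pt}\,a_{pr})$ and $$n_3=2\pi\left(q_{pr}a_{pr}^{2/\alpha}+(1-q_{pr})b_{pr}^{2/\alpha}\right)\left(q_{st}a_{st}^{2/\alpha}+(1-q_{st})b_{st}^{2/\alpha}\right).$$ This $n_3$ equals the average secondary directivity $\mathbb E_{\omega}\left[\int_0^{2\pi}\left(g_{pr}(\theta)\,g_{st}(\theta-\pi-\omega)\right)^{2/\alpha}d\theta\right]$,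 where $\omega$ is uniform on $[0,2\pi)$. In particular, for ideal beams ($b_{pr}=b_{st}=0$) the same formula holds with $n_3=2\pi\,q_{pr}\,q_{st}\,(a_{pr}a_{st})^{2/\alpha}$. -/

import Mathlib

open MeasureTheory ProbabilityTheory
open scoped ENNReal NNReal

namespace CognitiveNetwork

noncomputable section

/-! The plane is `ℂ` with Lebesgue area. The primary receiver is at the origin and the primary
transmitter is on the positive real axis, so the receiver's beam points along that axis and
`Complex.arg z` is the direction of a point `z` with respect to the primary link. -/

/-- Sectorized beam pattern with beamwidth `φ`, main lobe gain `a` and side lobe gain `b`, as a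
`2π`-periodic function of the angle `θ` to the beam orientation: the angle is first reduced to
its representative in `(-π, π]`. -/
def sectorBeam (φ a b θ : ℝ) : ℝ :=
  if |(θ : Real.Angle).toReal| ≤ φ / 2 then a else b

/-- The probability that a uniformly random direction falls into a main lobe of width `φ`. -/
def mainLobeProb (φ : ℝ) : ℝ := φ / (2 * Real.pi)

/-- The number of points (counted with multiplicity) of the point process `{X i}` in `B`. -/
def pointCount {Ω : Type*} (X : ℕ → Ω → ℂ) (B : Set ℂ) (w : Ω) : ℕ∞ :=
  {i : ℕ | X i w ∈ B}.encard

/-- `{X i}` is (an enumeration of) a homogeneous Poisson point process in the plane with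
density `lam > 0`: the number of points in a set of finite area is Poisson distributed with mean
`lam` times the area, and the numbers of points in disjoint sets are independent. -/
structure IsPoissonProcess {Ω : Type*} [MeasurableSpace Ω] (P : Measure Ω) (lam : ℝ)
    (X : ℕ → Ω → ℂ) : Prop where
  measurable : ∀ i, Measurable (X i)
  count_law : ∀ B : Set ℂ, MeasurableSet B → volume B ≠ ∞ →
    HasLaw (pointCount X B)
      ((poissonMeasure (ENNReal.ofReal lam * volume B).toNNReal).map (fun n : ℕ => (n : ℕ∞))) P
  count_indep : ∀ (n : ℕ) (B : Fin n → Set ℂ), (∀ k, MeasurableSet (B k)) →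
    (∀ k, volume (B k) ≠ ∞) → Pairwise (fun k l => Disjoint (B k) (B l)) →
    iIndepFun (fun k => pointCount X (B k)) P

/-- The random quantities seen by the primary receiver. The secondary transmitters `X i` form a
Poisson process of density `lam`. The `i`-th one has a mark `om i` (the orientation of its link,
uniform on `[0, 2π)`) and a cross-link fading coefficient `G i` (exponential with mean `1`, that
is, Rayleigh fading). `H` is the fading coefficient of the primary link, also exponential with
mean `1`. The point process, all the marks, all the cross-link fadings and `H` are mutually
independent. -/
structure IsNetwork {Ω : Type*} [MeasurableSpace Ω] (P : Measure Ω) (lam : ℝ)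
    (X : ℕ → Ω → ℂ) (om G : ℕ → Ω → ℝ) (H : Ω → ℝ) : Prop where
  poisson : IsPoissonProcess P lam X
  measurable_om : ∀ i, Measurable (om i)
  measurable_G : ∀ i, Measurable (G i)
  measurable_H : Measurable H
  law_om : ∀ i, pdf.IsUniform (om i) (Set.Ico 0 (2 * Real.pi)) P volume
  law_G : ∀ i, HasLaw (G i) (expMeasure 1) P
  law_H : HasLaw H (expMeasure 1) P
  indep_om : iIndepFun om P
  indep_G : iIndepFun G P
  indep_X_om : IndepFun (fun w i => X i w) (fun w i => om i w) P
  indep_X_om_G : IndepFun (fun w => ((fun i => X i w), (fun i => om i w))) (fun w i => G i w) P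
  indep_X_om_G_H :
    IndepFun (fun w => ((fun i => X i w), (fun i => om i w), (fun i => G i w))) H P

/-- Power received at the primary receiver from a secondary transmitter at `x` whose link has
orientation `o` and whose cross-link fading coefficient is `h`. -/
def receivedPower (α ps : ℝ) (gpr gst : ℝ → ℝ) (x : ℂ) (o h : ℝ) : ℝ :=
  ps * h * gpr x.arg * gst (x.arg - Real.pi - o) * ‖x‖ ^ (-α)

/-- Interference at the primary receiver: the sum of the received powers over the active secondary
transmitters, those whose received power is less than the threshold `ρ`. It takes values in
`[0, ∞]`, so that the sum is always meaningful. -/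
def interference {Ω : Type*} (α ps ρ : ℝ) (gpr gst : ℝ → ℝ)
    (X : ℕ → Ω → ℂ) (om G : ℕ → Ω → ℝ) (w : Ω) : ℝ≥0∞ :=
  ∑' i, ENNReal.ofReal
    (if receivedPower α ps gpr gst (X i w) (om i w) (G i w) < ρ
      then receivedPower α ps gpr gst (X i w) (om i w) (G i w) else 0)

/-- The SINR at the primary receiver, with values in `[0, ∞]`. The noise power is `σ2`. -/
def primarySINR {Ω : Type*} (α rp pp ps σ2 ρ : ℝ) (gpt gpr gst : ℝ → ℝ)
    (X : ℕ → Ω → ℂ) (om G : ℕ → Ω → ℝ) (H : Ω → ℝ) (w : Ω) : ℝ≥0∞ :=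
  ENNReal.ofReal (H w * pp * gpt 0 * gpr 0 * rp ^ (-α)) /
    (ENNReal.ofReal σ2 + interference α ps ρ gpr gst X om G w)

/-- The SINR coverage probability of the primary link at the SINR threshold `τ`. -/
def primaryCoverage {Ω : Type*} [MeasurableSpace Ω] (P : Measure Ω)
    (α rp pp ps σ2 ρ τ : ℝ) (gpt gpr gst : ℝ → ℝ)
    (X : ℕ → Ω → ℂ) (om G : ℕ → Ω → ℝ) (H : Ω → ℝ) : ℝ :=
  P.real {w | ENNReal.ofReal τ < primarySINR α rp pp ps σ2 ρ gpt gpr gst X om G H w}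

/-- `n₁(α) = π csc (2π/α)`. -/
def nOne (α : ℝ) : ℝ := Real.pi / Real.sin (2 * Real.pi / α)

/-- `n₂(α, ν) = ∫_ν^∞ e^{-u} / (u (u - ν)^{-2/α}) du`. -/
def nTwo (α ν : ℝ) : ℝ :=
  ∫ u in Set.Ioi ν, Real.exp (-u) / (u * (u - ν) ^ (-(2 / α)))

/-- The average secondary directivity
`n₃ = E_ω [∫_0^{2π} (g_pr(θ) g_st(θ - π - ω))^{2/α} dθ]`, with `ω` uniform on `[0, 2π)`. -/
def nThree (α : ℝ) (gpr gst : ℝ → ℝ) : ℝ :=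
  (2 * Real.pi)⁻¹ * ∫ o in (0 : ℝ)..(2 * Real.pi), ∫ θ in (0 : ℝ)..(2 * Real.pi),
    (gpr θ * gst (θ - Real.pi - o)) ^ (2 / α)

/-- The closed formula for the primary coverage in terms of `κ_p` and `n₃`. -/
def coverageFormula (α lam ps σ2 ρ τ κ n3 : ℝ) : ℝ :=
  Real.exp (-(σ2 * κ * τ / ρ) - lam / α * (ps ^ (2 / α) / ρ ^ (2 / α)) *
    (κ ^ (2 / α) * τ ^ (2 / α) * nOne α - Real.Gamma (2 / α) + nTwo α (κ * τ)) * n3)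

end

end CognitiveNetwork

namespace CognitiveNetwork

open Filter Topology

/-! ### The decreasing exponential on `[0, ∞]` -/

/-! Write `δ = 2/α`. Because `H` is exponential and independent of the interference `I`,
conditioning on `I` turns the coverage into `E[exp(-s (σ² + I))]` with `s = τ r_p^α / (p_p a_pt
a_pr)` (`IsNetwork.measure_lt_primarySINR`). What remains is the Laplace transform of `I`.

The independent marks can be averaged out point by point, so the Laplace functional of the Poisson
process gives `exp(-λ ∫ E[1 - exp(-s P 1(P < ρ))] dx)`, where `P` is the power received from a
transmitter at `x` (`IsNetwork.lintegral_expNeg_tsum`). The activity rule depends on a transmitter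
only through its received power. In polar coordinates `P = c r^(-α)`, with `c` collecting transmit
power, fading and gains; taking `t = c r^(-α)` as the radial variable turns the radial integral into
`c^δ / α` times `∫_0^ρ (1 - e^(-st)) t^(-1-δ) dt`. Fading, angle and orientation thus enter only
through `c^δ`, whose average is `p_s^δ Γ(1+δ)` times the directivity `n₃`
(`lintegral_truncatedLoss_receivedPower`). For sectorized beams `n₃` is a product, since the uniform
orientation makes the mean of the transmitter gain independent of the angle.

The integral over `(0, ρ)` is the one over the whole half-line minus its tail. The half-line yields
`Γ(1-δ)`, hence the cosecant by reflection; the tail yields `Γ(δ)` and `n₂`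
(`lintegral_one_sub_exp_mul_rpow_Ioo`).

Working in `[0, ∞]` with `e^(-∞) = 0` avoids convergence questions for infinite sums and integrals.
Almost sure finiteness of `I` is still needed and follows from its Laplace transform tending to `1`
as `s → 0`. -/

/-- The function `x ↦ e⁻ˣ` on `[0, ∞]`, with `e^{-∞} = 0`. -/
noncomputable def expNeg (x : ℝ≥0∞) : ℝ≥0∞ := EReal.exp (-(x : EReal))

lemma expNeg_zero : expNeg 0 = 1 := by simp [expNeg]

lemma expNeg_top : expNeg ∞ = 0 := by simp [expNeg]

lemma expNeg_ofReal {x : ℝ} (hx : 0 ≤ x) :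
    expNeg (ENNReal.ofReal x) = ENNReal.ofReal (Real.exp (-x)) := by
  rw [expNeg, EReal.coe_ennreal_ofReal, max_eq_left hx, ← EReal.coe_neg, EReal.exp_coe]

lemma expNeg_add (x y : ℝ≥0∞) : expNeg (x + y) = expNeg x * expNeg y := by
  rw [expNeg, expNeg, expNeg, ← EReal.exp_add, EReal.coe_ennreal_add, EReal.neg_add]
  · rfl
  · left; simp
  · right; simp

lemma expNeg_sum {ι : Type*} (s : Finset ι) (f : ι → ℝ≥0∞) :
    expNeg (∑ i ∈ s, f i) = ∏ i ∈ s, expNeg (f i) := by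
  classical
  induction s using Finset.induction_on with
  | empty => simp [expNeg_zero]
  | insert i s hi ih => rw [Finset.sum_insert hi, Finset.prod_insert hi, expNeg_add, ih]

lemma expNeg_mul_natCast (x : ℝ≥0∞) (n : ℕ) : expNeg (x * n) = expNeg x ^ n := by
  induction n with
  | zero => simp [expNeg_zero]
  | succ n ih => rw [Nat.cast_add, mul_add, expNeg_add, ih, pow_succ]; simp

lemma expNeg_antitone : Antitone expNeg := fun _ _ h ↦
  EReal.exp_monotone (EReal.neg_le_neg_iff.2 (EReal.coe_ennreal_le_coe_ennreal_iff.2 h))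

lemma expNeg_le_one (x : ℝ≥0∞) : expNeg x ≤ 1 := by
  rw [← expNeg_zero]; exact expNeg_antitone (zero_le)

lemma expNeg_ne_top (x : ℝ≥0∞) : expNeg x ≠ ∞ :=
  ne_top_of_le_ne_top ENNReal.one_ne_top (expNeg_le_one x)

lemma continuous_expNeg : Continuous expNeg :=
  ENNReal.continuous_exp.comp (continuous_neg.comp continuous_coe_ennreal_ereal)

@[fun_prop]
lemma measurable_expNeg : Measurable expNeg := continuous_expNeg.measurable

/-- The inverse of `expNeg` on `[0, 1]`. -/
noncomputable def negLog (v : ℝ≥0∞) : ℝ≥0∞ := (-(ENNReal.log v)).toENNReal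

@[fun_prop]
lemma measurable_negLog : Measurable negLog :=
  measurable_ereal_toENNReal.comp (continuous_neg.measurable.comp ENNReal.measurable_log)

lemma expNeg_negLog {v : ℝ≥0∞} (hv : v ≤ 1) : expNeg (negLog v) = v := by
  rw [expNeg, negLog, EReal.coe_toENNReal, neg_neg, ENNReal.exp_log]
  simpa using hv

/-- Reduces a functional of the whole point process to finite products, on which independence of the
marks can be used factor by factor. -/
lemma tendsto_prod_expNeg (f : ℕ → ℝ≥0∞) :
    Tendsto (fun n ↦ ∏ i ∈ Finset.range n, expNeg (f i)) atTop (𝓝 (expNeg (∑' i, f i))) := by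
  simp_rw [← expNeg_sum]
  exact (continuous_expNeg.tendsto _).comp ENNReal.summable.hasSum.tendsto_sum_nat

lemma exists_expNeg_eq {x : ℝ≥0∞} : ∃ q : ℝ, 0 ≤ q ∧ q ≤ 1 ∧ expNeg x = ENNReal.ofReal q := by
  refine ⟨(expNeg x).toReal, ENNReal.toReal_nonneg, ?_, (ENNReal.ofReal_toReal (expNeg_ne_top x)).symm⟩
  exact ENNReal.toReal_le_of_le_ofReal zero_le_one (by simpa using expNeg_le_one x)

/-! ### The Laplace functional of a Poisson process -/

/-- The Poisson generating function `E[q^N] = e^(-m(1-q))` at `q = e^(-c)`; the case `c = ∞`, `q =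
0` is included. -/
lemma lintegral_expNeg_poissonMeasure (m : ℝ≥0) (c : ℝ≥0∞) :
    ∫⁻ n, expNeg (c * (n : ℕ)) ∂(poissonMeasure m) = expNeg (m * (1 - expNeg c)) := by
  obtain ⟨q, hq0, hq1, hq⟩ := exists_expNeg_eq (x := c)
  simp_rw [expNeg_mul_natCast, hq]
  rw [poissonMeasure, lintegral_sum_measure]
  simp_rw [lintegral_smul_measure, lintegral_dirac, smul_eq_mul, ← ENNReal.ofReal_pow hq0]
  have h1 : (1 : ℝ≥0∞) - ENNReal.ofReal q = ENNReal.ofReal (1 - q) := by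
    rw [ENNReal.ofReal_sub _ hq0, ENNReal.ofReal_one]
  have h2 : (m : ℝ≥0∞) = ENNReal.ofReal m := by simp
  rw [h1, h2, ← ENNReal.ofReal_mul m.coe_nonneg, expNeg_ofReal (mul_nonneg m.coe_nonneg (by linarith))]
  have h3 : ∀ n : ℕ, ENNReal.ofReal (Real.exp (-m) * m ^ n / n.factorial) * ENNReal.ofReal (q ^ n) =
      ENNReal.ofReal (Real.exp (-m) * ((m * q) ^ n / n.factorial)) := fun n ↦ by
    rw [← ENNReal.ofReal_mul (by positivity), mul_pow]; congr 1; ring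
  simp_rw [h3]
  have h4 : HasSum (fun n : ℕ ↦ Real.exp (-m) * ((m * q) ^ n / n.factorial))
      (Real.exp (-m) * Real.exp (m * q)) := by
    have := NormedSpace.expSeries_div_hasSum_exp (m * q : ℝ)
    rw [← Real.exp_eq_exp_ℝ] at this
    exact this.mul_left _
  rw [← ENNReal.ofReal_tsum_of_nonneg (fun n ↦ by positivity) h4.summable, h4.tsum_eq,
    ← Real.exp_add]
  congr 2; ring

lemma tsum_indicator_eq_mul_pointCount {Ω : Type*} (X : ℕ → Ω → ℂ) {B : Set ℂ} (c : ℝ≥0∞) (w : Ω) :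
    ∑' i, B.indicator (fun _ ↦ c) (X i w) = c * (pointCount X B w : ℝ≥0∞) := by
  rw [pointCount, ← Measure.count_apply .of_discrete, ← lintegral_count]
  exact lintegral_indicator_const (μ := Measure.count) (s := {i | X i w ∈ B}) .of_discrete c

variable {Ω : Type*} [MeasurableSpace Ω]

lemma IsPoissonProcess.lintegral_expNeg_mul_pointCount {P : Measure Ω} {lam : ℝ} {X : ℕ → Ω → ℂ}
    (h : IsPoissonProcess P lam X) {B : Set ℂ} (hB : MeasurableSet B) (hB' : volume B ≠ ∞)
    (c : ℝ≥0∞) :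
    ∫⁻ w, expNeg (c * (pointCount X B w : ℝ≥0∞)) ∂P =
      expNeg (ENNReal.ofReal lam * volume B * (1 - expNeg c)) := by
  have hl := h.count_law B hB hB'
  have hf : Measurable (fun k : ℕ∞ ↦ expNeg (c * (k : ℝ≥0∞))) := .of_discrete
  rw [← lintegral_map' (f := fun k : ℕ∞ ↦ expNeg (c * (k : ℝ≥0∞))) hf.aemeasurable hl.aemeasurable, hl.map_eq,
    lintegral_map hf .of_discrete]
  simp only [ENat.toENNReal_coe]
  rw [lintegral_expNeg_poissonMeasure, ENNReal.coe_toNNReal]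
  exact ENNReal.mul_ne_top ENNReal.ofReal_ne_top hB'

lemma simpleFunc_eq_sum_indicator (f : SimpleFunc ℂ ℝ≥0∞) (x : ℂ) :
    f x = ∑ c ∈ f.range.filter (· ≠ 0), (f ⁻¹' {c}).indicator (fun _ ↦ c) x := by
  classical
  by_cases hx : f x = 0
  · rw [hx, Finset.sum_eq_zero]
    intro c hc
    rw [Set.indicator_of_notMem]
    intro hxc
    simp only [Set.mem_preimage, Set.mem_singleton_iff] at hxc
    exact (Finset.mem_filter.1 hc).2 (hxc ▸ hx)
  · rw [Finset.sum_eq_single_of_mem (f x) (by simp [hx])]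
    · simp
    · intro c _ hc
      rw [Set.indicator_of_notMem]
      simpa using hc.symm

/-- The fibres of `f` are disjoint, so their counts are independent Poisson variables and the
expectation factors into generating functions. -/
lemma IsPoissonProcess.lintegral_expNeg_tsum_simpleFunc {P : Measure Ω}
    {lam : ℝ} {X : ℕ → Ω → ℂ} (h : IsPoissonProcess P lam X) (f : SimpleFunc ℂ ℝ≥0∞)
    (hf : f.FinMeasSupp volume) :
    ∫⁻ w, expNeg (∑' i, f (X i w)) ∂P =
      expNeg (ENNReal.ofReal lam * ∫⁻ x, (1 - expNeg (f x))) := by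
  classical
  -- The value `0` is left out: its fibre has infinite area, so no count law applies to it, and it
  -- contributes nothing to either side.
  set S := f.range.filter (· ≠ 0) with hS
  have hX := h.measurable
  have hfin : ∀ c : S, volume (f ⁻¹' {(c : ℝ≥0∞)}) ≠ ∞ := fun c ↦
    (hf.meas_preimage_singleton_ne_zero (Finset.mem_filter.1 c.2).2).ne
  have hmeas : ∀ c : S, MeasurableSet (f ⁻¹' {(c : ℝ≥0∞)}) := fun c ↦ f.measurableSet_fiber _
  have hdisj : Pairwise (fun c d : S ↦ Disjoint (f ⁻¹' {(c : ℝ≥0∞)}) (f ⁻¹' {(d : ℝ≥0∞)})) := by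
    intro c d hcd
    refine Disjoint.preimage _ ?_
    exact Set.disjoint_singleton.2 (fun h ↦ hcd (Subtype.ext h))
  have hind : iIndepFun (fun c : S ↦ pointCount X (f ⁻¹' {(c : ℝ≥0∞)})) P := by
    let e := Fintype.equivFin S
    have := h.count_indep (Fintype.card S) (fun k ↦ f ⁻¹' {((e.symm k : S) : ℝ≥0∞)})
      (fun k ↦ hmeas _) (fun k ↦ hfin _) (fun k l hkl ↦ hdisj (e.symm.injective.ne hkl))
    have h2 := this.precomp e.injective
    simp only [Equiv.symm_apply_apply] at h2
    exact h2
  have hsum : ∀ w, ∑' i, f (X i w) =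
      ∑ c : S, (c : ℝ≥0∞) * (pointCount X (f ⁻¹' {(c : ℝ≥0∞)}) w : ℝ≥0∞) := by
    intro w
    simp_rw [simpleFunc_eq_sum_indicator f]
    rw [Summable.tsum_finsetSum (fun _ _ ↦ ENNReal.summable)]
    simp_rw [tsum_indicator_eq_mul_pointCount X]
    exact (Finset.sum_coe_sort S (fun c ↦ c * (pointCount X (f ⁻¹' {c}) w : ℝ≥0∞))).symm
  simp_rw [hsum, expNeg_sum]
  rw [lintegral_prod_eq_prod_lintegral_of_indepFun Finset.univ
    (fun (c : S) w ↦ expNeg ((c : ℝ≥0∞) * (pointCount X (f ⁻¹' {(c : ℝ≥0∞)}) w : ℝ≥0∞)))]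
  · simp_rw [fun c : S ↦ h.lintegral_expNeg_mul_pointCount (hmeas c) (hfin c) c]
    rw [← expNeg_sum]
    congr 1
    simp_rw [mul_assoc, ← Finset.mul_sum]
    congr 1
    have hpt : ∀ x, 1 - expNeg (f x) =
        ∑ c : S, (f ⁻¹' {(c : ℝ≥0∞)}).indicator (fun _ ↦ 1 - expNeg c) x := by
      intro x
      by_cases hx : f x = 0
      · rw [hx, expNeg_zero, tsub_self, Finset.sum_eq_zero]
        intro c _
        rw [Set.indicator_of_notMem]
        intro hxc
        simp only [Set.mem_preimage, Set.mem_singleton_iff] at hxc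
        exact (Finset.mem_filter.1 c.2).2 (hxc ▸ hx)
      · rw [Finset.sum_eq_single_of_mem (⟨f x, by simp [hS, hx]⟩ : S) (Finset.mem_univ _)]
        · simp
        · intro c _ hc
          rw [Set.indicator_of_notMem]
          intro hxc
          exact hc (Subtype.ext hxc.symm)
    simp_rw [hpt]
    rw [lintegral_finsetSum _ (fun c _ ↦ measurable_const.indicator (hmeas c))]
    refine Finset.sum_congr rfl fun c _ ↦ ?_
    rw [lintegral_indicator_const (hmeas c), mul_comm]
  · exact hind.comp (fun (c : S) (k : ℕ∞) ↦ expNeg ((c : ℝ≥0∞) * (k : ℝ≥0∞)))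
      (fun c ↦ .of_discrete)
  · intro c
    simp_rw [← tsum_indicator_eq_mul_pointCount X]
    refine measurable_expNeg.comp (Measurable.tsum fun i ↦ ?_)
    exact (measurable_const.indicator (hmeas c)).comp (hX i)

/-- The Laplace functional of a homogeneous Poisson process. -/
theorem IsPoissonProcess.lintegral_expNeg_tsum {P : Measure Ω} [IsProbabilityMeasure P]
    {lam : ℝ} {X : ℕ → Ω → ℂ} (h : IsPoissonProcess P lam X) {f : ℂ → ℝ≥0∞} (hf : Measurable f) :
    ∫⁻ w, expNeg (∑' i, f (X i w)) ∂P =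
      expNeg (ENNReal.ofReal lam * ∫⁻ x, (1 - expNeg (f x))) := by
  have hX := h.measurable
  -- Restricting to growing balls gives supports of finite area while keeping the approximation
  -- increasing.
  let g : ℕ → SimpleFunc ℂ ℝ≥0∞ := fun n ↦ (SimpleFunc.eapprox f n).restrict (Metric.closedBall 0 n)
  have hg_apply : ∀ n x, g n x = (Metric.closedBall (0 : ℂ) n).indicator (SimpleFunc.eapprox f n) x :=
    fun n x ↦ by rw [SimpleFunc.restrict_apply _ Metric.isClosed_closedBall.measurableSet]
  have hg_mono : Monotone (fun n x ↦ g n x) := by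
    intro n m hnm x
    simp only [hg_apply]
    exact (Set.indicator_le_indicator_of_subset
      (Metric.closedBall_subset_closedBall (by exact_mod_cast hnm)) (fun _ ↦ zero_le) x).trans
      (Set.indicator_le_indicator (SimpleFunc.monotone_eapprox f hnm x))
  have hg_lim : ∀ x, Tendsto (fun n ↦ g n x) atTop (𝓝 (f x)) := by
    intro x
    refine (SimpleFunc.tendsto_eapprox hf x).congr' ?_
    obtain ⟨N, hN⟩ := exists_nat_ge ‖x‖
    filter_upwards [eventually_ge_atTop N] with n hn
    rw [hg_apply, Set.indicator_of_mem]
    simpa using hN.trans (by exact_mod_cast hn)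
  have hg_fin : ∀ n, (g n).FinMeasSupp volume := by
    intro n
    refine SimpleFunc.finMeasSupp_iff.2 fun y hy ↦ ?_
    refine (measure_mono (t := Metric.closedBall (0 : ℂ) n) ?_).trans_lt
      measure_closedBall_lt_top
    intro x hx
    by_contra hxn
    simp only [Set.mem_preimage, Set.mem_singleton_iff, hg_apply, Set.indicator_of_notMem hxn] at hx
    exact hy hx.symm
  have hL : Tendsto (fun n ↦ ∫⁻ w, expNeg (∑' i, g n (X i w)) ∂P) atTop
      (𝓝 (∫⁻ w, expNeg (∑' i, f (X i w)) ∂P)) := by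
    refine tendsto_lintegral_of_dominated_convergence (fun _ ↦ 1) (fun n ↦ ?_) (fun n ↦ ?_)
      (by simp) ?_
    · exact measurable_expNeg.comp (Measurable.tsum fun i ↦ (g n).measurable.comp (hX i))
    · exact .of_forall fun w ↦ expNeg_le_one _
    · refine .of_forall fun w ↦ (continuous_expNeg.tendsto _).comp ?_
      -- As an integral against counting measure, the sum over points converges by monotone
      -- convergence, even when the limit is infinite.
      simp_rw [← lintegral_count]
      exact lintegral_tendsto_of_tendsto_of_monotone (fun n ↦ .of_discrete)
        (.of_forall fun i n m hnm ↦ hg_mono hnm _) (.of_forall fun i ↦ hg_lim _)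
  have hR : Tendsto (fun n ↦ expNeg (ENNReal.ofReal lam * ∫⁻ x, (1 - expNeg (g n x)))) atTop
      (𝓝 (expNeg (ENNReal.ofReal lam * ∫⁻ x, (1 - expNeg (f x))))) := by
    refine (continuous_expNeg.tendsto _).comp (ENNReal.Tendsto.const_mul ?_ (.inr ENNReal.ofReal_ne_top))
    refine lintegral_tendsto_of_tendsto_of_monotone (fun n ↦ ?_)
        (.of_forall fun x n m hnm ↦ ?_) (.of_forall fun x ↦ ?_)
    · exact (measurable_const.sub (measurable_expNeg.comp (g n).measurable)).aemeasurable
    · exact tsub_le_tsub_left (expNeg_antitone (hg_mono hnm x)) _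
    · exact ENNReal.Tendsto.sub tendsto_const_nhds ((continuous_expNeg.tendsto _).comp (hg_lim x))
        (.inl ENNReal.one_ne_top)
  refine tendsto_nhds_unique hL (hR.congr fun n ↦ ?_)
  exact (h.lintegral_expNeg_tsum_simpleFunc (g n) (hg_fin n)).symm

end CognitiveNetwork

namespace CognitiveNetwork

open Filter Topology

/-! ### Independent marks -/

variable {Ω : Type*} [MeasurableSpace Ω]

/-- Independent marks may be integrated out one by one, conditionally on `Y`. -/
lemma lintegral_prod_marks {𝓨 : Type*} [MeasurableSpace 𝓨] {P : Measure Ω} [IsProbabilityMeasure P]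
    {Y : Ω → 𝓨} {Z : ℕ → Ω → ℝ} {ν : Measure ℝ} (hY : Measurable Y) (hZ : ∀ i, Measurable (Z i))
    (hlaw : ∀ i, P.map (Z i) = ν) (hind : iIndepFun Z P) (hYZ : IndepFun Y (fun w i ↦ Z i w) P)
    {F : ℕ → 𝓨 × ℝ → ℝ≥0∞} (hF : ∀ i, Measurable (F i)) (n : ℕ) :
    ∫⁻ w, ∏ i ∈ Finset.range n, F i (Y w, Z i w) ∂P =
      ∫⁻ w, ∏ i ∈ Finset.range n, ∫⁻ z, F i (Y w, z) ∂ν ∂P := by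
  have : IsProbabilityMeasure ν := hlaw 0 ▸ Measure.isProbabilityMeasure_map (hZ 0).aemeasurable
  have hZ' : Measurable (fun w i ↦ Z i w) := measurable_pi_lambda _ hZ
  have hmap := (indepFun_iff_map_prod_eq_prod_map_map hY.aemeasurable hZ'.aemeasurable).1 hYZ
  have hZp : IsProbabilityMeasure (P.map (fun w i ↦ Z i w)) :=
    Measure.isProbabilityMeasure_map hZ'.aemeasurable
  have hYp : IsProbabilityMeasure (P.map Y) := Measure.isProbabilityMeasure_map hY.aemeasurable
  have hK : Measurable (fun p : 𝓨 × (ℕ → ℝ) ↦ ∏ i ∈ Finset.range n, F i (p.1, p.2 i)) := by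
    refine Finset.measurable_prod _ fun i _ ↦ (hF i).comp ?_
    exact measurable_fst.prodMk ((measurable_pi_apply i).comp measurable_snd)
  calc ∫⁻ w, ∏ i ∈ Finset.range n, F i (Y w, Z i w) ∂P
      = ∫⁻ p, ∏ i ∈ Finset.range n, F i (p.1, p.2 i) ∂(P.map (fun w ↦ (Y w, fun i ↦ Z i w))) :=
        (lintegral_map hK (hY.prodMk hZ')).symm
    _ = ∫⁻ y, ∫⁻ z, ∏ i ∈ Finset.range n, F i (y, z i) ∂(P.map (fun w i ↦ Z i w)) ∂(P.map Y) := by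
        rw [hmap, lintegral_prod _ hK.aemeasurable]
    _ = ∫⁻ y, ∏ i ∈ Finset.range n, ∫⁻ z, F i (y, z) ∂ν ∂(P.map Y) := by
        refine lintegral_congr fun y ↦ ?_
        have hKy : Measurable fun z : ℕ → ℝ ↦ ∏ i ∈ Finset.range n, F i (y, z i) :=
          hK.comp measurable_prodMk_left
        rw [lintegral_map hKy hZ']
        have hFy : ∀ i, Measurable (fun z ↦ F i (y, z)) := fun i ↦ (hF i).comp measurable_prodMk_left
        rw [lintegral_prod_eq_prod_lintegral_of_indepFun _ (fun i w ↦ F i (y, Z i w))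
          (hind.comp (fun i z ↦ F i (y, z)) hFy) (fun i ↦ (hFy i).comp (hZ i))]
        refine Finset.prod_congr rfl fun i _ ↦ ?_
        rw [← hlaw i, lintegral_map (hFy i) (hZ i)]
    _ = _ := lintegral_map (Finset.measurable_prod _ fun i _ ↦ (hF i).lintegral_prod_right') hY

/-- The common law of the link orientations. -/
noncomputable abbrev orientationLaw : Measure ℝ :=
  ProbabilityTheory.cond volume (Set.Ico 0 (2 * Real.pi))

instance : IsProbabilityMeasure orientationLaw := by
  refine cond_isProbabilityMeasure_of_finite ?_ ?_
  · simp [Real.pi_pos]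
  · rw [Real.volume_Ico]
    exact ENNReal.ofReal_ne_top

instance : IsProbabilityMeasure (expMeasure 1) := isProbabilityMeasure_expMeasure one_pos

/-- The Laplace functional of the network of marked secondary transmitters. -/
theorem IsNetwork.lintegral_expNeg_tsum {P : Measure Ω} [IsProbabilityMeasure P] {lam : ℝ}
    {X : ℕ → Ω → ℂ} {om G : ℕ → Ω → ℝ} {H : Ω → ℝ} (h : IsNetwork P lam X om G H)
    {g : ℂ → ℝ → ℝ → ℝ≥0∞} (hg : Measurable fun p : (ℂ × ℝ) × ℝ ↦ g p.1.1 p.1.2 p.2) :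
    ∫⁻ w, expNeg (∑' i, g (X i w) (om i w) (G i w)) ∂P =
      expNeg (ENNReal.ofReal lam * ∫⁻ x, ∫⁻ o, ∫⁻ t, (1 - expNeg (g x o t))
        ∂(expMeasure 1) ∂orientationLaw) := by
  have hX := h.poisson.measurable
  have hXm : Measurable (fun w i ↦ X i w) := measurable_pi_lambda _ hX
  have hom := h.measurable_om
  have homm : Measurable (fun w i ↦ om i w) := measurable_pi_lambda _ hom
  have hG := h.measurable_G
  have hF : Measurable fun p : (ℂ × ℝ) × ℝ ↦ expNeg (g p.1.1 p.1.2 p.2) := measurable_expNeg.comp hg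
  have hF1 : Measurable fun p : ℂ × ℝ ↦ ∫⁻ t, expNeg (g p.1 p.2 t) ∂(expMeasure 1) :=
    hF.lintegral_prod_right'
  have hF2 : Measurable fun x : ℂ ↦ ∫⁻ o, ∫⁻ t, expNeg (g x o t) ∂(expMeasure 1) ∂orientationLaw :=
    hF1.lintegral_prod_right'
  have hF_le : ∀ x o, ∫⁻ t, expNeg (g x o t) ∂(expMeasure 1) ≤ 1 := fun x o ↦
    (lintegral_mono fun t ↦ expNeg_le_one _).trans (by simp)
  have hF2_le : ∀ x, ∫⁻ o, ∫⁻ t, expNeg (g x o t) ∂(expMeasure 1) ∂orientationLaw ≤ 1 := fun x ↦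
    (lintegral_mono fun o ↦ hF_le x o).trans (by simp)
  -- The mark average lies in `[0, 1]`, so it equals `e^(-f(x))` for some `f(x)` in `[0, ∞]`. The
  -- marked functional then becomes the unmarked functional of `f`; the value `∞` covers a zero
  -- average.
  set f : ℂ → ℝ≥0∞ := fun x ↦ negLog (∫⁻ o, ∫⁻ t, expNeg (g x o t) ∂(expMeasure 1) ∂orientationLaw)
    with hf
  have hfm : Measurable f := measurable_negLog.comp hF2
  have hfe : ∀ x, expNeg (f x) = ∫⁻ o, ∫⁻ t, expNeg (g x o t) ∂(expMeasure 1) ∂orientationLaw :=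
    fun x ↦ expNeg_negLog (hF2_le x)
  have hgi : ∀ i, Measurable fun w ↦ g (X i w) (om i w) (G i w) := fun i ↦
    hg.comp (((hX i).prodMk (hom i)).prodMk (hG i))
  have hfin : ∀ n, ∫⁻ w, ∏ i ∈ Finset.range n, expNeg (g (X i w) (om i w) (G i w)) ∂P =
      ∫⁻ w, ∏ i ∈ Finset.range n, expNeg (f (X i w)) ∂P := by
    intro n
    simp_rw [hfe]
    -- Two rounds of averaging: the fadings given positions and orientations, then the orientations
    -- given positions.
    rw [← lintegral_prod_marks (Y := fun w i ↦ X i w) (Z := om) (ν := orientationLaw)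
      (F := fun i p ↦ ∫⁻ t, expNeg (g (p.1 i) p.2 t) ∂(expMeasure 1)) hXm hom h.law_om h.indep_om
      h.indep_X_om (fun i ↦ hF1.comp
        (f := fun p : (ℕ → ℂ) × ℝ ↦ (p.1 i, p.2))
        (((measurable_pi_apply i).comp measurable_fst).prodMk measurable_snd)) n]
    exact lintegral_prod_marks (Y := fun w ↦ (fun i ↦ X i w, fun i ↦ om i w)) (Z := G)
      (ν := expMeasure 1) (F := fun i p ↦ expNeg (g (p.1.1 i) (p.1.2 i) p.2)) (hXm.prodMk homm) hG
      (fun i ↦ (h.law_G i).map_eq) h.indep_G h.indep_X_om_G (fun i ↦ hF.comp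
        (f := fun p : ((ℕ → ℂ) × (ℕ → ℝ)) × ℝ ↦ ((p.1.1 i, p.1.2 i), p.2))
        ((((measurable_pi_apply i).comp (measurable_fst.comp measurable_fst)).prodMk
          ((measurable_pi_apply i).comp (measurable_snd.comp measurable_fst))).prodMk
          measurable_snd)) n
  have hlim : ∀ a : ℕ → Ω → ℝ≥0∞, (∀ i, Measurable (a i)) →
      Tendsto (fun n ↦ ∫⁻ w, ∏ i ∈ Finset.range n, expNeg (a i w) ∂P) atTop
        (𝓝 (∫⁻ w, expNeg (∑' i, a i w) ∂P)) := by
    intro a ha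
    refine tendsto_lintegral_of_dominated_convergence (fun _ ↦ 1) (fun n ↦ ?_) (fun n ↦ ?_)
      (by simp) (.of_forall fun w ↦ tendsto_prod_expNeg _)
    · exact Finset.measurable_prod _ fun i _ ↦ measurable_expNeg.comp (ha i)
    · exact .of_forall fun w ↦ Finset.prod_le_one' fun i _ ↦ expNeg_le_one _
  have hkey : ∫⁻ w, expNeg (∑' i, g (X i w) (om i w) (G i w)) ∂P =
      ∫⁻ w, expNeg (∑' i, f (X i w)) ∂P :=
    tendsto_nhds_unique (hlim _ hgi)
      ((hlim _ fun i ↦ hfm.comp (hX i)).congr fun n ↦ (hfin n).symm)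
  rw [hkey, h.poisson.lintegral_expNeg_tsum hfm]
  congr 2
  refine lintegral_congr fun x ↦ ?_
  have hFx : Measurable fun p : ℝ × ℝ ↦ expNeg (g x p.1 p.2) :=
    hF.comp ((measurable_const.prodMk measurable_fst).prodMk measurable_snd)
  rw [hfe]
  have h1 : ∀ o, ∫⁻ t, (1 - expNeg (g x o t)) ∂(expMeasure 1) =
      1 - ∫⁻ t, expNeg (g x o t) ∂(expMeasure 1) := fun o ↦ by
    have hFo : Measurable fun t ↦ expNeg (g x o t) := hFx.comp measurable_prodMk_left
    rw [lintegral_sub hFo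
      (ne_top_of_le_ne_top ENNReal.one_ne_top (hF_le x o)) (.of_forall fun t ↦ expNeg_le_one _)]
    simp
  simp_rw [h1]
  rw [lintegral_sub hFx.lintegral_prod_right'
    (ne_top_of_le_ne_top ENNReal.one_ne_top (hF2_le x)) (.of_forall fun o ↦ hF_le x o)]
  simp

end CognitiveNetwork

namespace CognitiveNetwork

open Set

/-! ### One-dimensional integrals -/

lemma lintegral_rpow_mul_exp_neg_mul_Ioi {a r : ℝ} (ha : 0 < a) (hr : 0 < r) :
    ∫⁻ t in Ioi 0, ENNReal.ofReal (t ^ (a - 1) * Real.exp (-(r * t))) =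
      ENNReal.ofReal ((1 / r) ^ a * Real.Gamma a) := by
  have h := Real.integral_rpow_mul_exp_neg_mul_Ioi ha hr
  have hpos : 0 < (1 / r) ^ a * Real.Gamma a := by
    have := Real.Gamma_pos_of_pos ha
    positivity
  rw [← h, ofReal_integral_eq_lintegral_ofReal]
  -- Integrability comes for free: a non-integrable function would have Bochner integral `0`, but
  -- the known value is positive.
  · by_contra hn
    rw [integral_undef hn] at h
    exact hpos.ne h
  · filter_upwards [ae_restrict_mem measurableSet_Ioi] with t ht
    have : (0 : ℝ) < t := ht
    positivity

lemma lintegral_exp_neg_mul_Ioi {r : ℝ} (hr : 0 < r) (a : ℝ) :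
    ∫⁻ t in Ioi a, ENNReal.ofReal (Real.exp (-(r * t))) =
      ENNReal.ofReal (Real.exp (-(r * a)) / r) := by
  have hi : IntegrableOn (fun t ↦ Real.exp (-r * t)) (Ioi a) := exp_neg_integrableOn_Ioi a hr
  have h := integral_exp_mul_Ioi (neg_lt_zero.2 hr) a
  simp_rw [neg_mul] at h hi
  rw [← ofReal_integral_eq_lintegral_ofReal hi (.of_forall fun _ ↦ (Real.exp_pos _).le), h]
  congr 1
  rw [neg_div_neg_eq]

lemma lintegral_rpow_Ioi {δ ρ : ℝ} (hδ : 0 < δ) (hρ : 0 < ρ) :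
    ∫⁻ t in Ioi ρ, ENNReal.ofReal (t ^ (-1 - δ)) = ENNReal.ofReal (ρ ^ (-δ) / δ) := by
  have hi : IntegrableOn (fun t : ℝ ↦ t ^ (-1 - δ)) (Ioi ρ) :=
    integrableOn_Ioi_rpow_of_lt (by linarith) hρ
  have h := integral_Ioi_rpow_of_lt (show -1 - δ < -1 by linarith) hρ
  rw [← ofReal_integral_eq_lintegral_ofReal hi, h]
  · congr 1
    rw [show -1 - δ + 1 = -δ by ring, neg_div_neg_eq]
  · filter_upwards [ae_restrict_mem measurableSet_Ioi] with t ht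
    exact Real.rpow_nonneg (hρ.le.trans (le_of_lt ht)) _

lemma lintegral_rpow_Ioc {δ s : ℝ} (hδ : 0 < δ) (hs : 0 ≤ s) :
    ∫⁻ y in Ioc 0 s, ENNReal.ofReal (y ^ (δ - 1)) = ENNReal.ofReal (s ^ δ / δ) := by
  have hi : IntegrableOn (fun t : ℝ ↦ t ^ (δ - 1)) (Ioc 0 s) := by
    rw [← intervalIntegrable_iff_integrableOn_Ioc_of_le hs]
    exact intervalIntegral.intervalIntegrable_rpow' (by linarith)
  rw [← ofReal_integral_eq_lintegral_ofReal hi, ← intervalIntegral.integral_of_le hs,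
    integral_rpow (.inl (by linarith))]
  · congr 1
    rw [sub_add_cancel, Real.zero_rpow hδ.ne', sub_zero]
  · filter_upwards [ae_restrict_mem measurableSet_Ioc] with t ht
    exact Real.rpow_nonneg ht.1.le _

lemma lintegral_mul_exp_neg_mul_Ioc {t s : ℝ} (ht : 0 < t) (hs : 0 ≤ s) :
    ∫⁻ y in Ioc 0 s, ENNReal.ofReal (t * Real.exp (-(t * y))) =
      ENNReal.ofReal (1 - Real.exp (-(s * t))) := by
  have hc : Continuous fun y ↦ t * Real.exp (-(t * y)) := by fun_prop
  rw [← ofReal_integral_eq_lintegral_ofReal (hc.integrableOn_Ioc)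
    (.of_forall fun y ↦ by positivity), ← intervalIntegral.integral_of_le hs]
  congr 1
  rw [intervalIntegral.integral_eq_sub_of_hasDerivAt (f := fun y ↦ -Real.exp (-(t * y)))]
  · simp [mul_comm]; ring
  · intro y _
    have := (((hasDerivAt_id y).const_mul t).neg.exp).neg
    convert! this using 1
    simp; ring
  · exact hc.intervalIntegrable _ _

/-- The integral of `(1 - e^{-st}) t^{-1-δ}` over the half-line. -/
lemma lintegral_one_sub_exp_mul_rpow_Ioi {δ s : ℝ} (hδ : 0 < δ) (hδ1 : δ < 1) (hs : 0 ≤ s) :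
    ∫⁻ t in Ioi 0, ENNReal.ofReal ((1 - Real.exp (-(s * t))) * t ^ (-1 - δ)) =
      ENNReal.ofReal (s ^ δ * Real.Gamma (1 - δ) / δ) := by
  -- Write `1 - e^(-st) = ∫_0^s t e^(-ty) dy` and exchange integrals; the inner one is a Gamma
  -- integral, convergent since `δ < 1`.
  calc ∫⁻ t in Ioi 0, ENNReal.ofReal ((1 - Real.exp (-(s * t))) * t ^ (-1 - δ))
      = ∫⁻ t in Ioi 0, ∫⁻ y in Ioc 0 s, ENNReal.ofReal (t ^ (-δ) * Real.exp (-(y * t))) := by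
        refine setLIntegral_congr_fun measurableSet_Ioi fun t ht ↦ ?_
        have ht : 0 < t := ht
        rw [ENNReal.ofReal_mul' (by positivity), ← lintegral_mul_exp_neg_mul_Ioc ht hs,
          ← lintegral_mul_const _ (by fun_prop)]
        refine lintegral_congr fun y ↦ ?_
        rw [← ENNReal.ofReal_mul (by positivity)]
        congr 1
        rw [show -δ = 1 + (-1 - δ) by ring, Real.rpow_add ht, Real.rpow_one, mul_comm y t]
        ring
    _ = ∫⁻ y in Ioc 0 s, ∫⁻ t in Ioi 0, ENNReal.ofReal (t ^ (-δ) * Real.exp (-(y * t))) :=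
        lintegral_lintegral_swap (by fun_prop)
    _ = ∫⁻ y in Ioc 0 s, ENNReal.ofReal (y ^ (δ - 1)) * ENNReal.ofReal (Real.Gamma (1 - δ)) := by
        refine setLIntegral_congr_fun measurableSet_Ioc fun y hy ↦ ?_
        have hy : 0 < y := hy.1
        have h := lintegral_rpow_mul_exp_neg_mul_Ioi (show 0 < 1 - δ by linarith) hy
        simp only [show 1 - δ - 1 = -δ by ring] at h
        rw [h, ← ENNReal.ofReal_mul (by positivity)]
        congr 2
        rw [one_div, Real.inv_rpow hy.le, ← Real.rpow_neg hy.le, neg_sub]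
    _ = _ := by
        rw [lintegral_mul_const _ (by fun_prop), lintegral_rpow_Ioc hδ hs,
          ← ENNReal.ofReal_mul (by positivity)]
        congr 1; ring

/-- The tail integral of `e^{-st} t^{-1-δ}` in terms of `n₂`. -/
lemma lintegral_exp_mul_rpow_Ioi {α s ρ : ℝ} (hα : 0 < α) (hs : 0 ≤ s) (hρ : 0 < ρ) :
    ENNReal.ofReal (Real.Gamma (1 + 2 / α)) *
        ∫⁻ t in Ioi ρ, ENNReal.ofReal (Real.exp (-(s * t)) * t ^ (-1 - 2 / α)) =
      ENNReal.ofReal (ρ ^ (-(2 / α))) * ∫⁻ u in Ioi (s * ρ),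
        ENNReal.ofReal (Real.exp (-u) / (u * (u - s * ρ) ^ (-(2 / α)))) := by
  set δ := 2 / α with hδ_def
  have hδ : 0 < δ := by positivity
  have hΓ : 0 < Real.Gamma (1 + δ) := Real.Gamma_pos_of_pos (by linarith)
  -- The factor `Γ(1+δ) t^(-1-δ)` is `∫_0^∞ y^δ e^(-ty) dy`. After exchanging, the integral in `t`
  -- is a pure exponential tail.
  calc ENNReal.ofReal (Real.Gamma (1 + δ)) *
        ∫⁻ t in Ioi ρ, ENNReal.ofReal (Real.exp (-(s * t)) * t ^ (-1 - δ))
      = ∫⁻ t in Ioi ρ, ∫⁻ y in Ioi 0, ENNReal.ofReal (y ^ δ * Real.exp (-((s + y) * t))) := by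
        rw [← lintegral_const_mul _ (by fun_prop)]
        refine setLIntegral_congr_fun measurableSet_Ioi fun t ht ↦ ?_
        have ht : 0 < t := hρ.trans ht
        have h := lintegral_rpow_mul_exp_neg_mul_Ioi (show 0 < 1 + δ by linarith) ht
        simp only [add_sub_cancel_left] at h
        have h2 : ∀ y, ENNReal.ofReal (y ^ δ * Real.exp (-((s + y) * t))) =
            ENNReal.ofReal (Real.exp (-(s * t))) * ENNReal.ofReal (y ^ δ * Real.exp (-(t * y))) := by
          intro y
          rw [← ENNReal.ofReal_mul (by positivity),
            show -((s + y) * t) = -(s * t) + -(t * y) by ring, Real.exp_add]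
          congr 1; ring
        simp_rw [h2]
        rw [lintegral_const_mul _ (by fun_prop), h, ← ENNReal.ofReal_mul (by positivity),
          ← ENNReal.ofReal_mul (by positivity)]
        congr 1
        rw [one_div, Real.inv_rpow ht.le, ← Real.rpow_neg ht.le, show -(1 + δ) = -1 - δ by ring]
        ring
    _ = ∫⁻ y in Ioi 0, ∫⁻ t in Ioi ρ, ENNReal.ofReal (y ^ δ * Real.exp (-((s + y) * t))) :=
        lintegral_lintegral_swap (by fun_prop)
    _ = ∫⁻ y in Ioi 0, ENNReal.ofReal (y ^ δ * (Real.exp (-((s + y) * ρ)) / (s + y))) := by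
        refine setLIntegral_congr_fun measurableSet_Ioi fun y hy ↦ ?_
        have hy : 0 < y := hy
        rw [ENNReal.ofReal_mul (by positivity), ← lintegral_exp_neg_mul_Ioi (by positivity),
          ← lintegral_const_mul _ (by fun_prop)]
        refine lintegral_congr fun t ↦ ?_
        rw [← ENNReal.ofReal_mul (by positivity)]
    _ = ENNReal.ofReal (ρ ^ (-δ)) * ∫⁻ u in Ioi (s * ρ),
        ENNReal.ofReal (Real.exp (-u) / (u * (u - s * ρ) ^ (-δ))) := by
        -- The substitution `u = ρ (s + y)` produces the form of `n₂`.
        have himg : (fun y ↦ ρ * y + s * ρ) '' Ioi 0 = Ioi (s * ρ) := by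
          ext u
          simp only [mem_image, mem_Ioi]
          refine ⟨?_, fun hu ↦ ⟨(u - s * ρ) / ρ, div_pos (by linarith) hρ, by field_simp; ring⟩⟩
          rintro ⟨y, hy, rfl⟩
          have := mul_pos hρ hy
          linarith
        rw [← himg, lintegral_image_eq_lintegral_abs_deriv_mul measurableSet_Ioi
          (f' := fun _ ↦ ρ)]
        · rw [← lintegral_const_mul _ (by fun_prop)]
          refine setLIntegral_congr_fun measurableSet_Ioi fun y hy ↦ ?_
          have hy : 0 < y := hy
          rw [← ENNReal.ofReal_mul (by positivity), ← ENNReal.ofReal_mul (by positivity)]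
          congr 1
          rw [abs_of_pos hρ, add_sub_cancel_right, Real.mul_rpow hρ.le hy.le,
            show ρ * y + s * ρ = (s + y) * ρ by ring, Real.rpow_neg hy.le]
          have h1 : ρ ^ (-δ) ≠ 0 := (Real.rpow_pos_of_pos hρ _).ne'
          have h2 : y ^ δ ≠ 0 := (Real.rpow_pos_of_pos hy _).ne'
          have h3 : s + y ≠ 0 := by positivity
          field_simp
        · intro y _
          simpa using (((hasDerivAt_id y).const_mul ρ).add_const (s * ρ)).hasDerivWithinAt
        · intro x _ y _ hxy
          simpa [hρ.ne'] using hxy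

/-- The truncated integral of `(1 - e^{-st}) t^{-1-δ}`, which is the Laplace exponent of the
received power restricted to be less than `ρ`. -/
lemma lintegral_one_sub_exp_mul_rpow_Ioo {α s ρ : ℝ} (hα : 2 < α) (hs : 0 ≤ s) (hρ : 0 < ρ) :
    ∫⁻ t in Ioo 0 ρ, ENNReal.ofReal ((1 - Real.exp (-(s * t))) * t ^ (-1 - 2 / α)) ≠ ∞ ∧
    Real.Gamma (1 + 2 / α) *
        (∫⁻ t in Ioo 0 ρ, ENNReal.ofReal ((1 - Real.exp (-(s * t))) * t ^ (-1 - 2 / α))).toReal =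
      ρ ^ (-(2 / α)) * ((s * ρ) ^ (2 / α) * nOne α - Real.Gamma (2 / α) + nTwo α (s * ρ)) := by
  have hα0 : 0 < α := by linarith
  have hB := lintegral_exp_mul_rpow_Ioi hα0 hs hρ
  have hone : nOne α = Real.Gamma (2 / α) * Real.Gamma (1 - 2 / α) := by
    rw [Real.Gamma_mul_Gamma_one_sub, nOne]; congr 2; ring
  have htwo : nTwo α (s * ρ) = (∫⁻ u in Ioi (s * ρ),
      ENNReal.ofReal (Real.exp (-u) / (u * (u - s * ρ) ^ (-(2 / α))))).toReal := by
    rw [nTwo, integral_eq_lintegral_of_nonneg_ae]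
    · filter_upwards [ae_restrict_mem measurableSet_Ioi] with u hu
      have h1 : 0 < u - s * ρ := sub_pos.2 hu
      have h2 : 0 < u := lt_of_le_of_lt (by positivity) (mem_Ioi.1 hu)
      simp only [Pi.zero_apply]
      positivity
    · exact Measurable.aestronglyMeasurable (by fun_prop)
  have hδ : 0 < 2 / α := by positivity
  have hδ1 : 2 / α < 1 := (div_lt_one hα0).2 hα
  rw [hone, htwo]
  set δ := 2 / α
  have hΓ : 0 < Real.Gamma (1 + δ) := Real.Gamma_pos_of_pos (by linarith)
  have hΓ2 : 0 < Real.Gamma (1 - δ) := Real.Gamma_pos_of_pos (by linarith)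
  have hΓδ : Real.Gamma (1 + δ) = δ * Real.Gamma δ := by
    rw [add_comm, Real.Gamma_add_one hδ.ne']
  have hT := lintegral_one_sub_exp_mul_rpow_Ioi hδ hδ1 hs
  have hC := lintegral_rpow_Ioi hδ hρ
  -- The bookkeeping is `T = A + D` and `D + B = C`, so `A = T + B - C`. The closed forms of `T` and
  -- `C` show that every term is finite, which makes the subtraction legitimate.
  set A := ∫⁻ t in Ioo 0 ρ, ENNReal.ofReal ((1 - Real.exp (-(s * t))) * t ^ (-1 - δ))
  set B := ∫⁻ t in Ioi ρ, ENNReal.ofReal (Real.exp (-(s * t)) * t ^ (-1 - δ))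
  set D := ∫⁻ t in Ioi ρ, ENNReal.ofReal ((1 - Real.exp (-(s * t))) * t ^ (-1 - δ))
  set C := ∫⁻ t in Ioi ρ, ENNReal.ofReal (t ^ (-1 - δ))
  set T := ∫⁻ t in Ioi 0, ENNReal.ofReal ((1 - Real.exp (-(s * t))) * t ^ (-1 - δ))
  set N := ∫⁻ u in Ioi (s * ρ), ENNReal.ofReal (Real.exp (-u) / (u * (u - s * ρ) ^ (-δ)))
  have hexp : ∀ t, 0 < t → 0 ≤ 1 - Real.exp (-(s * t)) := fun t ht ↦ by
    have := mul_nonneg hs ht.le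
    simpa using this
  have hTAD : T = A + D := by
    have : Ioi (0 : ℝ) = Ioc 0 ρ ∪ Ioi ρ := (Ioc_union_Ioi_eq_Ioi hρ.le).symm
    simp only [T, A, D]
    rw [this, lintegral_union measurableSet_Ioi (by
      rw [Set.disjoint_left]; intro x hx hx'; exact absurd hx.2 (not_le.2 hx')),
      restrict_Ioo_eq_restrict_Ioc]
  have hDB : D + B = C := by
    simp only [D, B, C]
    rw [← lintegral_add_left (by fun_prop)]
    refine setLIntegral_congr_fun measurableSet_Ioi fun t ht ↦ ?_
    have ht : 0 < t := hρ.trans ht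
    rw [← ENNReal.ofReal_add (mul_nonneg (hexp t ht) (by positivity)) (by positivity)]
    congr 1; ring
  have hTtop : T ≠ ∞ := by rw [hT]; exact ENNReal.ofReal_ne_top
  have hCtop : C ≠ ∞ := by rw [hC]; exact ENNReal.ofReal_ne_top
  have hAtop : A ≠ ∞ := ne_top_of_le_ne_top hTtop (hTAD ▸ le_self_add)
  have hDtop : D ≠ ∞ := ne_top_of_le_ne_top hCtop (hDB ▸ le_self_add)
  have hBtop : B ≠ ∞ := ne_top_of_le_ne_top hCtop (hDB ▸ le_add_self)
  refine ⟨hAtop, ?_⟩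
  have e1 : T.toReal = A.toReal + D.toReal := by rw [hTAD, ENNReal.toReal_add hAtop hDtop]
  have e2 : D.toReal + B.toReal = C.toReal := by rw [← hDB, ENNReal.toReal_add hDtop hBtop]
  have e3 : Real.Gamma (1 + δ) * B.toReal = ρ ^ (-δ) * N.toReal := by
    have := congrArg ENNReal.toReal hB
    rwa [ENNReal.toReal_mul, ENNReal.toReal_mul, ENNReal.toReal_ofReal hΓ.le,
      ENNReal.toReal_ofReal (by positivity)] at this
  have e4 : T.toReal = s ^ δ * Real.Gamma (1 - δ) / δ := by
    rw [hT, ENNReal.toReal_ofReal (by positivity)]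
  have e5 : C.toReal = ρ ^ (-δ) / δ := by rw [hC, ENNReal.toReal_ofReal (by positivity)]
  have e6 : A.toReal = T.toReal + B.toReal - C.toReal := by linarith
  rw [e6, mul_sub, mul_add, e3, e4, e5, hΓδ, Real.mul_rpow hs hρ.le]
  have h1 : ρ ^ (-δ) * ρ ^ δ = 1 := by rw [← Real.rpow_add hρ]; simp
  have h2 : δ * Real.Gamma δ * (s ^ δ * Real.Gamma (1 - δ) / δ) =
      (ρ ^ (-δ) * ρ ^ δ) * s ^ δ * (Real.Gamma δ * Real.Gamma (1 - δ)) := by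
    rw [h1]; field_simp
  rw [h2]
  field_simp
  ring

/-- Change of variables from the distance to the received power under power-law path loss. -/
lemma lintegral_mul_comp_pathLoss {α c : ℝ} (hα : 0 < α) (hc : 0 ≤ c) {F : ℝ → ℝ≥0∞}
    (hF : F 0 = 0) :
    ∫⁻ r in Ioi 0, ENNReal.ofReal r * F (c * r ^ (-α)) =
      ENNReal.ofReal (c ^ (2 / α) / α) *
        ∫⁻ t in Ioi 0, F t * ENNReal.ofReal (t ^ (-1 - 2 / α)) := by
  -- The case `c = 0` occurs when a side lobe gain vanishes; there `F 0 = 0` makes both sides zero.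
  rcases hc.eq_or_lt with rfl | hc
  · simp [hF, Real.zero_rpow (show 2 / α ≠ 0 by positivity)]
  have hinj : InjOn (fun t : ℝ ↦ (t / c) ^ (-(1 / α))) (Ioi 0) := by
    intro x hx y hy hxy
    have hx : 0 < x := hx
    have hy : 0 < y := hy
    have := Real.rpow_left_injOn (x := -(1 / α)) (neg_ne_zero.2 (by positivity))
      (show x / c ∈ {z : ℝ | 0 ≤ z} from (by positivity : 0 ≤ x / c))
      (show y / c ∈ {z : ℝ | 0 ≤ z} from (by positivity : 0 ≤ y / c)) hxy
    field_simp at this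
    exact this
  have hinv : ∀ t : ℝ, 0 < t → c * ((t / c) ^ (-(1 / α))) ^ (-α) = t := fun t ht ↦ by
    rw [← Real.rpow_mul (by positivity), show -(1 / α) * -α = 1 by field_simp, Real.rpow_one]
    field_simp
  have himg : (fun t : ℝ ↦ (t / c) ^ (-(1 / α))) '' Ioi 0 = Ioi 0 := by
    ext r
    simp only [mem_image, mem_Ioi]
    constructor
    · rintro ⟨t, ht, rfl⟩
      positivity
    · intro hr
      refine ⟨c * r ^ (-α), by positivity, ?_⟩
      rw [mul_div_cancel_left₀ _ hc.ne', ← Real.rpow_mul hr.le,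
        show -α * -(1 / α) = 1 by field_simp, Real.rpow_one]
  conv_lhs => rw [← himg]
  rw [lintegral_image_eq_lintegral_abs_deriv_mul measurableSet_Ioi
    (f' := fun t ↦ (1 / c) * -(1 / α) * (t / c) ^ (-(1 / α) - 1)) ?_ hinj,
    ← lintegral_const_mul' _ _ ENNReal.ofReal_ne_top]
  · refine setLIntegral_congr_fun measurableSet_Ioi fun t ht ↦ ?_
    have ht : 0 < t := ht
    rw [hinv t ht, ← mul_assoc, ← ENNReal.ofReal_mul (abs_nonneg _), mul_comm (F t), ← mul_assoc,
      ← ENNReal.ofReal_mul (by positivity)]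
    congr 2
    rw [abs_mul, abs_mul, abs_neg, abs_of_pos (by positivity : 0 < 1 / c),
      abs_of_pos (by positivity : 0 < 1 / α), abs_of_pos (by positivity), mul_assoc,
      ← Real.rpow_add (by positivity), Real.div_rpow ht.le hc.le]
    have h1 : -(1 / α) - 1 + -(1 / α) = -1 - 2 / α := by ring
    have h2 : c ^ (-1 - 2 / α) = (c * c ^ (2 / α))⁻¹ := by
      rw [show -1 - 2 / α = -(1 + 2 / α) by ring, Real.rpow_neg hc.le, Real.rpow_add hc,
        Real.rpow_one]
    rw [h1, h2]
    field_simp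
  · intro t ht
    have ht : 0 < t := ht
    have := ((hasDerivAt_id t).div_const c).rpow_const (p := -(1 / α))
      (.inl (by simp only [id]; positivity))
    simpa using this.hasDerivWithinAt

end CognitiveNetwork

namespace CognitiveNetwork

open Set

/-! ### Sectorized beams -/

/-- Cosine is strictly decreasing on `[0, π]`, which contains both compared quantities. This
describes the main lobe by a continuous function of the angle, hence as a measurable set. -/
lemma abs_toReal_le_iff {φ : ℝ} (hφ : 0 ≤ φ ∧ φ ≤ 2 * Real.pi) (θ : ℝ) :
    |(θ : Real.Angle).toReal| ≤ φ / 2 ↔ Real.cos (φ / 2) ≤ Real.cos θ := by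
  rw [← Real.Angle.cos_coe θ, ← Real.Angle.cos_toReal, ← Real.cos_abs (θ : Real.Angle).toReal]
  exact (Real.strictAntiOn_cos.le_iff_ge ⟨by linarith, by linarith⟩
    ⟨abs_nonneg _, Real.Angle.abs_toReal_le_pi _⟩).symm

lemma measurable_sectorBeam {φ : ℝ} (hφ : 0 ≤ φ ∧ φ ≤ 2 * Real.pi) (a b : ℝ) :
    Measurable (sectorBeam φ a b) := by
  refine Measurable.ite ?_ measurable_const measurable_const
  simp_rw [abs_toReal_le_iff hφ]
  exact measurableSet_le measurable_const Real.measurable_cos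

lemma sectorBeam_zero {φ : ℝ} (hφ : 0 ≤ φ) (a b : ℝ) : sectorBeam φ a b 0 = a := by
  rw [sectorBeam, if_pos]
  simpa using div_nonneg hφ zero_le_two

lemma sectorBeam_nonneg {a b : ℝ} (ha : 0 ≤ a) (hb : 0 ≤ b) (φ θ : ℝ) : 0 ≤ sectorBeam φ a b θ := by
  unfold sectorBeam
  split_ifs <;> assumption

lemma sectorBeam_rpow (φ a b θ δ : ℝ) :
    sectorBeam φ a b θ ^ δ = sectorBeam φ (a ^ δ) (b ^ δ) θ :=
  apply_ite (· ^ δ) _ a b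

lemma abs_sectorBeam_le (φ a b θ : ℝ) : |sectorBeam φ a b θ| ≤ max |a| |b| := by
  unfold sectorBeam
  split_ifs
  · exact le_max_left _ _
  · exact le_max_right _ _

lemma sectorBeam_periodic (φ a b : ℝ) : Function.Periodic (sectorBeam φ a b) (2 * Real.pi) := by
  intro θ
  simp [sectorBeam]

/-- The mean of a sectorized beam with gains `a` and `b` over a uniform direction. -/
noncomputable def beamMean (φ a b : ℝ) : ℝ := mainLobeProb φ * a + (1 - mainLobeProb φ) * b

lemma integral_sectorBeam {φ : ℝ} (hφ : 0 ≤ φ ∧ φ ≤ 2 * Real.pi) (a b : ℝ) :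
    ∫ θ in (-Real.pi)..Real.pi, sectorBeam φ a b θ = 2 * Real.pi * beamMean φ a b := by
  have hpi := Real.pi_pos
  rw [intervalIntegral.integral_of_le (by linarith)]
  have h1 : ∫ θ in Ioc (-Real.pi) Real.pi, sectorBeam φ a b θ =
      ∫ θ in Ioc (-Real.pi) Real.pi, (b + (Icc (-(φ / 2)) (φ / 2)).indicator (fun _ ↦ a - b) θ) := by
    refine setIntegral_congr_fun measurableSet_Ioc fun θ hθ ↦ ?_
    have : (θ : Real.Angle).toReal = θ := Real.Angle.toReal_coe_eq_self_iff_mem_Ioc.2 hθ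
    simp only [sectorBeam, this, abs_le, indicator_apply, mem_Icc]
    split_ifs <;> ring
  rw [h1, integral_add (integrable_const _)
    ((integrable_const _).indicator measurableSet_Icc), setIntegral_const,
    setIntegral_indicator measurableSet_Icc, setIntegral_const]
  have h2 : volume.real (Ioc (-Real.pi) Real.pi ∩ Icc (-(φ / 2)) (φ / 2)) = φ := by
    -- Closing the left endpoint matters only for `φ = 2π`, when the lobe contains `-π`.
    have h3 : (Ioc (-Real.pi) Real.pi ∩ Icc (-(φ / 2)) (φ / 2) : Set ℝ) =ᵐ[volume]
        (Icc (-Real.pi) Real.pi ∩ Icc (-(φ / 2)) (φ / 2) : Set ℝ) :=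
      Ioc_ae_eq_Icc.inter (ae_eq_refl _)
    rw [measureReal_congr h3, inter_eq_right.2 (Icc_subset_Icc (by linarith) (by linarith)),
      Real.volume_real_Icc_of_le (by linarith)]
    ring
  rw [h2, Real.volume_real_Ioc_of_le (by linarith), beamMean, mainLobeProb, smul_eq_mul, smul_eq_mul]
  field_simp
  ring

lemma integral_sectorBeam_zero_two_pi {φ : ℝ} (hφ : 0 ≤ φ ∧ φ ≤ 2 * Real.pi) (a b : ℝ) :
    ∫ θ in (0 : ℝ)..(2 * Real.pi), sectorBeam φ a b θ = 2 * Real.pi * beamMean φ a b := by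
  rw [← integral_sectorBeam hφ]
  have := (sectorBeam_periodic φ a b).intervalIntegral_add_eq 0 (-Real.pi)
  rw [zero_add] at this
  rw [this]
  congr 1; ring

lemma integral_orientationLaw (f : ℝ → ℝ) :
    ∫ o, f o ∂orientationLaw = (2 * Real.pi)⁻¹ * ∫ o in (0 : ℝ)..(2 * Real.pi), f o := by
  have hpi := Real.pi_pos
  rw [orientationLaw, ProbabilityTheory.cond, integral_smul_measure, Real.volume_Ico,
    intervalIntegral.integral_of_le (by linarith), integral_Ico_eq_integral_Ioc,
    ENNReal.toReal_inv, ENNReal.toReal_ofReal (by linarith), sub_zero, smul_eq_mul]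

/-- By periodicity a uniform shift averages over a full period whatever `c` is. This is what
decouples the two beams in `n₃`. -/
lemma integral_sectorBeam_sub_orientation {φ : ℝ} (hφ : 0 ≤ φ ∧ φ ≤ 2 * Real.pi) (a b c : ℝ) :
    ∫ o, sectorBeam φ a b (c - o) ∂orientationLaw = beamMean φ a b := by
  have hpi := Real.pi_pos
  rw [integral_orientationLaw, intervalIntegral.integral_comp_sub_left (fun x ↦ sectorBeam φ a b x)]
  have := (sectorBeam_periodic φ a b).intervalIntegral_add_eq (c - 2 * Real.pi) (-Real.pi)
  rw [show c - 2 * Real.pi + 2 * Real.pi = c - 0 by ring,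
    show -Real.pi + 2 * Real.pi = Real.pi by ring, integral_sectorBeam hφ] at this
  rw [this]
  field_simp

lemma rpow_mul_sectorBeam {a b a' b' : ℝ} (ha : 0 ≤ a) (hb : 0 ≤ b) (ha' : 0 ≤ a') (hb' : 0 ≤ b')
    (φ φ' δ θ θ' : ℝ) : (sectorBeam φ a b θ * sectorBeam φ' a' b' θ') ^ δ =
      sectorBeam φ (a ^ δ) (b ^ δ) θ * sectorBeam φ' (a' ^ δ) (b' ^ δ) θ' := by
  rw [Real.mul_rpow (sectorBeam_nonneg ha hb _ _) (sectorBeam_nonneg ha' hb' _ _),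
    sectorBeam_rpow, sectorBeam_rpow]

/-- The average secondary directivity of sectorized beams. -/
theorem nThree_sectorBeam {φ φ' a b a' b' : ℝ} (hφ : 0 ≤ φ ∧ φ ≤ 2 * Real.pi)
    (hφ' : 0 ≤ φ' ∧ φ' ≤ 2 * Real.pi) (ha : 0 ≤ a) (hb : 0 ≤ b) (ha' : 0 ≤ a') (hb' : 0 ≤ b')
    (α : ℝ) :
    nThree α (sectorBeam φ a b) (sectorBeam φ' a' b') =
      2 * Real.pi * beamMean φ (a ^ (2 / α)) (b ^ (2 / α)) *
        beamMean φ' (a' ^ (2 / α)) (b' ^ (2 / α)) := by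
  have hpi := Real.pi_pos
  simp_rw [nThree, rpow_mul_sectorBeam ha hb ha' hb']
  rw [← integral_orientationLaw]
  simp_rw [intervalIntegral.integral_of_le (show (0 : ℝ) ≤ 2 * Real.pi by linarith)]
  -- With the orientation integrated first, the second beam contributes a constant.
  rw [integral_integral_swap]
  · simp_rw [integral_const_mul, integral_sectorBeam_sub_orientation hφ']
    rw [integral_mul_const, ← intervalIntegral.integral_of_le (by linarith),
      integral_sectorBeam_zero_two_pi hφ]
  · refine Integrable.of_bound (C := max |a ^ (2 / α)| |b ^ (2 / α)| *
      max |a' ^ (2 / α)| |b' ^ (2 / α)|) (Measurable.aestronglyMeasurable ?_) (.of_forall fun p ↦ ?_)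
    · exact ((measurable_sectorBeam hφ _ _).comp measurable_snd).mul
        ((measurable_sectorBeam hφ' _ _).comp
          ((measurable_snd.sub measurable_const).sub measurable_fst))
    · simp only [Function.uncurry, Real.norm_eq_abs, abs_mul]
      exact mul_le_mul (abs_sectorBeam_le _ _ _ _) (abs_sectorBeam_le _ _ _ _) (abs_nonneg _)
        ((abs_nonneg _).trans (le_max_left _ _))

lemma beamMean_nonneg {φ a b : ℝ} (hφ : 0 ≤ φ ∧ φ ≤ 2 * Real.pi) (ha : 0 ≤ a) (hb : 0 ≤ b) :
    0 ≤ beamMean φ a b := by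
  have hpi := Real.pi_pos
  have h1 : 0 ≤ mainLobeProb φ := div_nonneg hφ.1 (by linarith)
  have h2 : mainLobeProb φ ≤ 1 := (div_le_one (by linarith)).2 hφ.2
  exact add_nonneg (mul_nonneg h1 ha) (mul_nonneg (by linarith) hb)

/-- The average secondary directivity of sectorized beams as a Lebesgue integral. -/
lemma lintegral_directivity_sectorBeam {φ φ' a b a' b' : ℝ} (hφ : 0 ≤ φ ∧ φ ≤ 2 * Real.pi)
    (hφ' : 0 ≤ φ' ∧ φ' ≤ 2 * Real.pi) (ha : 0 ≤ a) (hb : 0 ≤ b) (ha' : 0 ≤ a') (hb' : 0 ≤ b')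
    (δ : ℝ) :
    ∫⁻ θ in Ioo (-Real.pi) Real.pi, ∫⁻ o, ENNReal.ofReal
        ((sectorBeam φ a b θ * sectorBeam φ' a' b' (θ - Real.pi - o)) ^ δ) ∂orientationLaw =
      ENNReal.ofReal (2 * Real.pi * beamMean φ (a ^ δ) (b ^ δ) * beamMean φ' (a' ^ δ) (b' ^ δ)) := by
  have hpi := Real.pi_pos
  have hA : 0 ≤ a ^ δ := by positivity
  have hB : 0 ≤ b ^ δ := by positivity
  have hA' : 0 ≤ a' ^ δ := by positivity
  have hB' : 0 ≤ b' ^ δ := by positivity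
  have hM : 0 ≤ beamMean φ' (a' ^ δ) (b' ^ δ) := beamMean_nonneg hφ' hA' hB'
  have hint : ∀ (μ : Measure ℝ) [IsFiniteMeasure μ] (φ a b : ℝ), 0 ≤ φ ∧ φ ≤ 2 * Real.pi →
      ∀ f : ℝ → ℝ, Measurable f → Integrable (fun x ↦ sectorBeam φ a b (f x)) μ := by
    intro μ _ φ a b hφ f hf
    exact Integrable.of_bound ((measurable_sectorBeam hφ _ _).comp hf).aestronglyMeasurable
      (max |a| |b|) (.of_forall fun x ↦ abs_sectorBeam_le _ _ _ _)
  have hinner : ∀ θ, ∫⁻ o, ENNReal.ofReal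
      ((sectorBeam φ a b θ * sectorBeam φ' a' b' (θ - Real.pi - o)) ^ δ) ∂orientationLaw =
      ENNReal.ofReal (sectorBeam φ (a ^ δ) (b ^ δ) θ * beamMean φ' (a' ^ δ) (b' ^ δ)) := by
    intro θ
    simp_rw [rpow_mul_sectorBeam ha hb ha' hb']
    rw [← integral_sectorBeam_sub_orientation hφ' _ _ (θ - Real.pi), ← integral_const_mul,
      ofReal_integral_eq_lintegral_ofReal
        ((hint _ _ _ _ hφ' (fun o ↦ θ - Real.pi - o) (by fun_prop)).const_mul _)]
    exact .of_forall fun o ↦ mul_nonneg (sectorBeam_nonneg hA hB _ _) (sectorBeam_nonneg hA' hB' _ _)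
  simp_rw [hinner]
  rw [← ofReal_integral_eq_lintegral_ofReal ((hint _ _ _ _ hφ (fun θ ↦ θ) measurable_id).mul_const _)
    (.of_forall fun θ ↦ mul_nonneg (sectorBeam_nonneg hA hB _ _) hM), integral_mul_const,
    ← integral_Ioc_eq_integral_Ioo, ← intervalIntegral.integral_of_le (by linarith)]
  rw [integral_sectorBeam hφ]

end CognitiveNetwork

namespace CognitiveNetwork

open Set

/-! ### The Laplace exponent of the interference -/

lemma lintegral_expMeasure {f : ℝ → ℝ≥0∞} (hf : Measurable f) :
    ∫⁻ h, f h ∂(expMeasure 1) = ∫⁻ h in Ioi 0, ENNReal.ofReal (Real.exp (-h)) * f h := by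
  have hd : expMeasure 1 = volume.withDensity (exponentialPDF 1) := rfl
  have hm : Measurable (exponentialPDF 1) := (measurable_exponentialPDFReal 1).ennreal_ofReal
  rw [hd, lintegral_withDensity_eq_lintegral_mul _ hm hf, ← lintegral_indicator measurableSet_Ioi]
  refine lintegral_congr_ae ?_
  -- The exponential density equals `1` at `0`, which lies outside `Ioi 0`, so that point is
  -- discarded.
  filter_upwards [Measure.ae_ne volume (0 : ℝ)] with h h0
  rcases lt_or_gt_of_ne h0 with hneg | hpos
  · simp [exponentialPDF_of_neg hneg, hneg.le]
  · simp [exponentialPDF_of_nonneg hpos.le, hpos]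

lemma expMeasure_Iic_zero : expMeasure 1 (Iic 0) = 0 := by
  rw [← lintegral_indicator_one measurableSet_Iic,
    lintegral_expMeasure (measurable_one.indicator measurableSet_Iic)]
  refine (setLIntegral_congr_fun measurableSet_Ioi fun h hh ↦ ?_).trans lintegral_zero
  rw [indicator_of_notMem (notMem_Iic.2 hh), mul_zero]

lemma ae_pos_expMeasure : ∀ᵐ h ∂(expMeasure 1), 0 < h := by
  rw [ae_iff]
  simpa [not_lt] using! expMeasure_Iic_zero

lemma expMeasure_Ioi {x : ℝ} (hx : 0 ≤ x) :
    expMeasure 1 (Ioi x) = ENNReal.ofReal (Real.exp (-x)) := by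
  rw [← lintegral_indicator_one measurableSet_Ioi,
    lintegral_expMeasure (measurable_one.indicator measurableSet_Ioi)]
  have h := lintegral_exp_neg_mul_Ioi one_pos x
  simp only [one_mul, div_one] at h
  rw [← h, ← lintegral_indicator measurableSet_Ioi, ← lintegral_indicator measurableSet_Ioi]
  refine lintegral_congr fun t ↦ ?_
  by_cases ht : x < t
  · simp [ht, hx.trans_lt ht]
  · simp [ht]

lemma lintegral_rpow_expMeasure {δ : ℝ} (hδ : 0 < δ) :
    ∫⁻ h, ENNReal.ofReal (h ^ δ) ∂(expMeasure 1) = ENNReal.ofReal (Real.Gamma (1 + δ)) := by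
  rw [lintegral_expMeasure (by fun_prop)]
  have h := lintegral_rpow_mul_exp_neg_mul_Ioi (show 0 < 1 + δ by linarith) one_pos
  simp only [add_sub_cancel_left, one_mul, div_one, Real.one_rpow] at h
  rw [← h]
  refine setLIntegral_congr_fun measurableSet_Ioi fun t ht ↦ ?_
  rw [← ENNReal.ofReal_mul (Real.exp_pos _).le, mul_comm]

/-- The loss `1 - e^{-st}` of the Laplace functional caused by a received power `t`, when powers
not less than `ρ` are switched off. -/
noncomputable def truncatedLoss (s ρ t : ℝ) : ℝ≥0∞ :=
  1 - expNeg (ENNReal.ofReal s * ENNReal.ofReal (if t < ρ then t else 0))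

@[fun_prop]
lemma measurable_truncatedLoss (s ρ : ℝ) : Measurable (truncatedLoss s ρ) := by
  refine measurable_const.sub (measurable_expNeg.comp (measurable_const.mul ?_))
  exact (Measurable.ite measurableSet_Iio measurable_id measurable_const).ennreal_ofReal

lemma truncatedLoss_zero (s ρ : ℝ) : truncatedLoss s ρ 0 = 0 := by
  simp [truncatedLoss, expNeg_zero]

/-- Received powers of at least `ρ` are switched off and cause no loss, so only `(0, ρ)`
contributes. -/
lemma lintegral_truncatedLoss {s ρ : ℝ} (hs : 0 ≤ s) (δ : ℝ) :
    ∫⁻ t in Ioi 0, truncatedLoss s ρ t * ENNReal.ofReal (t ^ (-1 - δ)) =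
      ∫⁻ t in Ioo 0 ρ, ENNReal.ofReal ((1 - Real.exp (-(s * t))) * t ^ (-1 - δ)) := by
  rw [← lintegral_indicator measurableSet_Ioi, ← lintegral_indicator measurableSet_Ioo]
  refine lintegral_congr fun t ↦ ?_
  by_cases ht : 0 < t
  · by_cases htρ : t < ρ
    · rw [indicator_of_mem (mem_Ioi.2 ht), indicator_of_mem (mem_Ioo.2 ⟨ht, htρ⟩), truncatedLoss, if_pos htρ,
        ← ENNReal.ofReal_mul hs, expNeg_ofReal (by positivity), ENNReal.ofReal_mul' (by positivity),
        ENNReal.ofReal_sub _ (Real.exp_pos _).le, ENNReal.ofReal_one]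
    · simp [ht, htρ, truncatedLoss, expNeg_zero]
  · simp [ht]

@[fun_prop]
lemma measurable_receivedPower {α ps : ℝ} {gpr gst : ℝ → ℝ} (hgpr : Measurable gpr)
    (hgst : Measurable gst) :
    Measurable fun p : (ℂ × ℝ) × ℝ ↦ receivedPower α ps gpr gst p.1.1 p.1.2 p.2 := by
  unfold receivedPower
  fun_prop

/-- The Laplace exponent of the truncated interference factors into the average directivity and a
one-dimensional integral. -/
theorem lintegral_truncatedLoss_receivedPower {α ps s ρ : ℝ} (hα : 0 < α) (hps : 0 ≤ ps) (hs : 0 ≤ s)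
    {gpr gst : ℝ → ℝ} (hgpr : Measurable gpr) (hgst : Measurable gst)
    (hgpr0 : ∀ θ, 0 ≤ gpr θ) (hgst0 : ∀ θ, 0 ≤ gst θ) :
    ∫⁻ x, ∫⁻ o, ∫⁻ h, truncatedLoss s ρ (receivedPower α ps gpr gst x o h)
        ∂(expMeasure 1) ∂orientationLaw =
      ENNReal.ofReal (ps ^ (2 / α) / α * Real.Gamma (1 + 2 / α)) *
        (∫⁻ θ in Ioo (-Real.pi) Real.pi, ∫⁻ o, ENNReal.ofReal
          ((gpr θ * gst (θ - Real.pi - o)) ^ (2 / α)) ∂orientationLaw) *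
        ∫⁻ t in Ioo 0 ρ, ENNReal.ofReal ((1 - Real.exp (-(s * t))) * t ^ (-1 - 2 / α)) := by
  rw [← lintegral_truncatedLoss hs]
  set K := ∫⁻ t in Ioi 0, truncatedLoss s ρ t * ENNReal.ofReal (t ^ (-1 - 2 / α))
  have hδ : 0 < 2 / α := by positivity
  set c : ℝ → ℝ → ℝ → ℝ := fun θ o h ↦ ps * h * gpr θ * gst (θ - Real.pi - o) with hc
  have hm' : ∀ θ, Measurable fun p : (ℝ × ℝ) × ℝ ↦ ENNReal.ofReal p.1.1 *
      truncatedLoss s ρ (c θ p.1.2 p.2 * p.1.1 ^ (-α)) := by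
    intro θ
    simp only [hc]
    fun_prop
  have hpol : ∀ p ∈ polarCoord.target, ENNReal.ofReal p.1 • (∫⁻ o, ∫⁻ h,
      truncatedLoss s ρ (receivedPower α ps gpr gst (Complex.polarCoord.symm p) o h)
        ∂(expMeasure 1) ∂orientationLaw) =
      ∫⁻ o, ∫⁻ h, ENNReal.ofReal p.1 * truncatedLoss s ρ (c p.2 o h * p.1 ^ (-α))
        ∂(expMeasure 1) ∂orientationLaw := by
    intro p hp
    have hp1 : 0 < p.1 := hp.1
    have harg : (Complex.polarCoord.symm p).arg = p.2 := by
      rw [Complex.polarCoord_symm_apply, Complex.ofReal_cos, Complex.ofReal_sin]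
      exact Complex.arg_mul_cos_add_sin_mul_I hp1 ⟨hp.2.1, hp.2.2.le⟩
    have hnorm : ‖Complex.polarCoord.symm p‖ = p.1 := by
      rw [Complex.norm_polarCoord_symm, abs_of_pos hp1]
    simp_rw [receivedPower, harg, hnorm]
    rw [smul_eq_mul, ← lintegral_const_mul' _ _ ENNReal.ofReal_ne_top]
    simp_rw [lintegral_const_mul' _ _ ENNReal.ofReal_ne_top]
    rfl
  have hinner : ∀ θ, ∫⁻ r in Ioi 0, ∫⁻ o, ∫⁻ h, ENNReal.ofReal r *
      truncatedLoss s ρ (c θ o h * r ^ (-α)) ∂(expMeasure 1) ∂orientationLaw =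
      ENNReal.ofReal (ps ^ (2 / α) / α * Real.Gamma (1 + 2 / α)) * (∫⁻ o, ENNReal.ofReal
          ((gpr θ * gst (θ - Real.pi - o)) ^ (2 / α)) ∂orientationLaw) * K := by
    intro θ
    rw [lintegral_lintegral_swap (hm' θ).lintegral_prod_right'.aemeasurable,
      ← lintegral_const_mul' _ _ ENNReal.ofReal_ne_top,
      ← lintegral_mul_const _ (by fun_prop)]
    refine lintegral_congr fun o ↦ ?_
    have hmo : Measurable fun p : ℝ × ℝ ↦ ENNReal.ofReal p.1 *
        truncatedLoss s ρ (c θ o p.2 * p.1 ^ (-α)) := by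
      simp only [hc]
      fun_prop
    rw [lintegral_lintegral_swap hmo.aemeasurable]
    have hg : 0 ≤ gpr θ * gst (θ - Real.pi - o) := mul_nonneg (hgpr0 _) (hgst0 _)
    -- For fixed marks the radial integral is `c^δ / α` times `K`, and `c^δ` splits into powers of
    -- transmit power, gains and fading. Averaging `h^δ` then gives `Γ(1+δ)`.
    have hh : ∀ᵐ h ∂(expMeasure 1), ∫⁻ r in Ioi 0, ENNReal.ofReal r *
        truncatedLoss s ρ (c θ o h * r ^ (-α)) = ENNReal.ofReal (ps ^ (2 / α) / α) *
          ENNReal.ofReal ((gpr θ * gst (θ - Real.pi - o)) ^ (2 / α)) * K *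
          ENNReal.ofReal (h ^ (2 / α)) := by
      filter_upwards [ae_pos_expMeasure] with h hpos
      have hcc : c θ o h = ps * h * (gpr θ * gst (θ - Real.pi - o)) := by simp only [hc]; ring
      rw [lintegral_mul_comp_pathLoss hα (hcc ▸ by positivity) (truncatedLoss_zero s ρ), hcc,
        Real.mul_rpow (by positivity) hg, Real.mul_rpow hps hpos.le, mul_right_comm _ K,
        ← ENNReal.ofReal_mul (by positivity), ← ENNReal.ofReal_mul (by positivity)]
      congr 2
      ring
    rw [lintegral_congr_ae hh, lintegral_const_mul _ (by fun_prop), lintegral_rpow_expMeasure hδ,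
      ENNReal.ofReal_mul (by positivity)]
    ring
  rw [← Complex.lintegral_comp_polarCoord_symm,
    setLIntegral_congr_fun polarCoord.open_target.measurableSet hpol, polarCoord_target,
    Measure.volume_eq_prod, ← Measure.prod_restrict, lintegral_prod_symm]
  · simp_rw [hinner]
    rw [lintegral_mul_const _ (by fun_prop), lintegral_const_mul' _ _ ENNReal.ofReal_ne_top]
  · have hm2 : Measurable fun p : ((ℝ × ℝ) × ℝ) × ℝ ↦ ENNReal.ofReal p.1.1.1 *
        truncatedLoss s ρ (c p.1.1.2 p.1.2 p.2 * p.1.1.1 ^ (-α)) := by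
      simp only [hc]
      fun_prop
    exact hm2.lintegral_prod_right'.lintegral_prod_right'.aemeasurable

end CognitiveNetwork

namespace CognitiveNetwork

open Filter Topology

/-! ### The primary coverage -/

variable {Ω : Type*} [MeasurableSpace Ω] {P : Measure Ω}
  {α lam ps ρ : ℝ} {gpr gst : ℝ → ℝ} {X : ℕ → Ω → ℂ} {om G : ℕ → Ω → ℝ} {H : Ω → ℝ}

lemma measurable_activePower (hgpr : Measurable gpr) (hgst : Measurable gst) :
    Measurable fun p : (ℂ × ℝ) × ℝ ↦ ENNReal.ofReal
      (if receivedPower α ps gpr gst p.1.1 p.1.2 p.2 < ρ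
        then receivedPower α ps gpr gst p.1.1 p.1.2 p.2 else 0) := by
  have h := measurable_receivedPower (α := α) (ps := ps) hgpr hgst
  exact (Measurable.ite (measurableSet_lt h measurable_const) h measurable_const).ennreal_ofReal

lemma IsNetwork.measurable_interference (h : IsNetwork P lam X om G H)
    (hgpr : Measurable gpr) (hgst : Measurable gst) :
    Measurable (interference α ps ρ gpr gst X om G) := by
  refine Measurable.tsum fun i ↦ ?_
  exact (measurable_activePower hgpr hgst).comp
    (((h.poisson.measurable i).prodMk (h.measurable_om i)).prodMk (h.measurable_G i))

variable [IsProbabilityMeasure P]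

/-- The Laplace transform of the interference. -/
theorem IsNetwork.lintegral_expNeg_mul_interference (h : IsNetwork P lam X om G H)
    (hα : 0 < α) (hps : 0 ≤ ps) (hgpr : Measurable gpr) (hgst : Measurable gst)
    (hgpr0 : ∀ θ, 0 ≤ gpr θ) (hgst0 : ∀ θ, 0 ≤ gst θ) {s : ℝ} (hs : 0 ≤ s) :
    ∫⁻ w, expNeg (ENNReal.ofReal s * interference α ps ρ gpr gst X om G w) ∂P =
      expNeg (ENNReal.ofReal lam * (ENNReal.ofReal (ps ^ (2 / α) / α * Real.Gamma (1 + 2 / α)) *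
        (∫⁻ θ in Set.Ioo (-Real.pi) Real.pi, ∫⁻ o, ENNReal.ofReal
          ((gpr θ * gst (θ - Real.pi - o)) ^ (2 / α)) ∂orientationLaw) *
        ∫⁻ t in Set.Ioo 0 ρ, ENNReal.ofReal ((1 - Real.exp (-(s * t))) * t ^ (-1 - 2 / α)))) := by
  rw [← lintegral_truncatedLoss_receivedPower hα hps hs hgpr hgst hgpr0 hgst0]
  simp_rw [interference, ← ENNReal.tsum_mul_left]
  exact h.lintegral_expNeg_tsum (g := fun x o t ↦ ENNReal.ofReal s * ENNReal.ofReal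
    (if receivedPower α ps gpr gst x o t < ρ then receivedPower α ps gpr gst x o t else 0))
    ((measurable_activePower hgpr hgst).const_mul _)

/-- The truncated Laplace exponent vanishes at `0`. -/
lemma tendsto_lintegral_one_sub_exp_mul_rpow {δ : ℝ} (hδ1 : δ < 1) (hρ : 0 < ρ) :
    Tendsto (fun n : ℕ ↦ ∫⁻ t in Set.Ioo 0 ρ,
      ENNReal.ofReal ((1 - Real.exp (-(((n : ℝ) + 1)⁻¹ * t))) * t ^ (-1 - δ))) atTop (𝓝 0) := by
  -- From `1 - e^(-x) ≤ x`; the remaining `t^(-δ)` is integrable near `0` because `δ < 1`.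
  have hbound : ∀ n : ℕ, ∫⁻ t in Set.Ioo 0 ρ,
      ENNReal.ofReal ((1 - Real.exp (-(((n : ℝ) + 1)⁻¹ * t))) * t ^ (-1 - δ)) ≤
      ENNReal.ofReal (((n : ℝ) + 1)⁻¹) * ENNReal.ofReal (ρ ^ (1 - δ) / (1 - δ)) := by
    intro n
    rw [← lintegral_rpow_Ioc (by linarith : 0 < 1 - δ) hρ.le, restrict_Ioo_eq_restrict_Ioc,
      ← lintegral_const_mul _ (by fun_prop)]
    refine setLIntegral_mono (by fun_prop) fun t ht ↦ ?_
    have ht0 : 0 < t := ht.1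
    rw [← ENNReal.ofReal_mul (by positivity)]
    refine ENNReal.ofReal_le_ofReal ?_
    have h1 := Real.add_one_le_exp (-(((n : ℝ) + 1)⁻¹ * t))
    calc (1 - Real.exp (-(((n : ℝ) + 1)⁻¹ * t))) * t ^ (-1 - δ)
        ≤ (((n : ℝ) + 1)⁻¹ * t) * t ^ (-1 - δ) := by gcongr; linarith
      _ = _ := by
        rw [show 1 - δ - 1 = 1 + (-1 - δ) by ring, Real.rpow_add ht0, Real.rpow_one, mul_assoc]
  refine tendsto_of_tendsto_of_tendsto_of_le_of_le tendsto_const_nhds ?_ (fun _ ↦ zero_le) hbound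
  have h1 : Tendsto (fun n : ℕ ↦ ENNReal.ofReal (((n : ℝ) + 1)⁻¹)) atTop (𝓝 0) := by
    have := tendsto_one_div_add_atTop_nhds_zero_nat (𝕜 := ℝ)
    simp only [one_div] at this
    simpa using ENNReal.tendsto_ofReal this
  simpa using ENNReal.Tendsto.mul_const h1 (.inr ENNReal.ofReal_ne_top)

/-- The interference is almost surely finite. -/
theorem IsNetwork.ae_interference_ne_top (h : IsNetwork P lam X om G H)
    (hα : 2 < α) (hps : 0 ≤ ps) (hρ : 0 < ρ) (hgpr : Measurable gpr) (hgst : Measurable gst)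
    (hgpr0 : ∀ θ, 0 ≤ gpr θ) (hgst0 : ∀ θ, 0 ≤ gst θ)
    (hdir : ∫⁻ θ in Set.Ioo (-Real.pi) Real.pi, ∫⁻ o, ENNReal.ofReal
      ((gpr θ * gst (θ - Real.pi - o)) ^ (2 / α)) ∂orientationLaw ≠ ∞) :
    ∀ᵐ w ∂P, interference α ps ρ gpr gst X om G w ≠ ∞ := by
  have hα0 : 0 < α := by linarith
  have hI := h.measurable_interference (α := α) (ps := ps) (ρ := ρ) hgpr hgst
  set I := interference α ps ρ gpr gst X om G
  have hset : MeasurableSet {w | I w ≠ ∞} := (measurableSet_singleton ∞).compl.preimage hI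
  -- For `ε > 0`, `e^(-εI)` is bounded by the indicator of `I < ∞`. Letting `ε = 1/(n+1)` tend to
  -- `0` forces that event to have probability `1`.
  have hle : ∀ n : ℕ, ∫⁻ w, expNeg (ENNReal.ofReal (((n : ℝ) + 1)⁻¹) * I w) ∂P ≤
      P {w | I w ≠ ∞} := by
    intro n
    rw [← lintegral_indicator_one hset]
    refine lintegral_mono fun w ↦ ?_
    by_cases hw : I w = ∞
    · have : ENNReal.ofReal (((n : ℝ) + 1)⁻¹) ≠ 0 := by
        rw [Ne, ENNReal.ofReal_eq_zero, not_le]; positivity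
      rw [hw, ENNReal.mul_top this, expNeg_top]
      exact zero_le
    · rw [Set.indicator_of_mem (show w ∈ {w | I w ≠ ∞} from hw)]
      exact expNeg_le_one _
  have hlim : Tendsto (fun n : ℕ ↦ ∫⁻ w, expNeg (ENNReal.ofReal (((n : ℝ) + 1)⁻¹) * I w) ∂P) atTop
      (𝓝 1) := by
    refine Tendsto.congr (fun n : ℕ ↦ (h.lintegral_expNeg_mul_interference (ρ := ρ) hα0 hps hgpr
      hgst hgpr0 hgst0 (show (0 : ℝ) ≤ ((n : ℝ) + 1)⁻¹ by positivity)).symm) ?_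
    rw [← expNeg_zero]
    refine (continuous_expNeg.tendsto _).comp ?_
    have h0 := tendsto_lintegral_one_sub_exp_mul_rpow ((div_lt_one hα0).2 hα) hρ
    have h1 := ENNReal.Tendsto.const_mul (a := ENNReal.ofReal lam) (ENNReal.Tendsto.const_mul
      (a := ENNReal.ofReal (ps ^ (2 / α) / α * Real.Gamma (1 + 2 / α)) *
        ∫⁻ θ in Set.Ioo (-Real.pi) Real.pi, ∫⁻ o, ENNReal.ofReal
          ((gpr θ * gst (θ - Real.pi - o)) ^ (2 / α)) ∂orientationLaw) h0
      (.inr (ENNReal.mul_ne_top ENNReal.ofReal_ne_top hdir))) (.inr ENNReal.ofReal_ne_top)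
    simpa using h1
  have h1 : P {w | I w ≠ ∞} = 1 := le_antisymm prob_le_one (le_of_tendsto' hlim hle)
  exact (prob_compl_eq_zero_iff hset).2 h1

/-- The coverage probability in terms of the Laplace transform of the interference. -/
theorem IsNetwork.measure_lt_primarySINR (h : IsNetwork P lam X om G H)
    {rp pp σ2 τ : ℝ} {gpt : ℝ → ℝ} (hτ : 0 ≤ τ) (hc : 0 < pp * gpt 0 * gpr 0 * rp ^ (-α))
    (hgpr : Measurable gpr) (hgst : Measurable gst)
    (hfin : ∀ᵐ w ∂P, interference α ps ρ gpr gst X om G w ≠ ∞) :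
    P {w | ENNReal.ofReal τ < primarySINR α rp pp ps σ2 ρ gpt gpr gst X om G H w} =
      ∫⁻ w, expNeg (ENNReal.ofReal (τ / (pp * gpt 0 * gpr 0 * rp ^ (-α))) *
        (ENNReal.ofReal σ2 + interference α ps ρ gpr gst X om G w)) ∂P := by
  set c := pp * gpt 0 * gpr 0 * rp ^ (-α) with hc_def
  have hI := h.measurable_interference (α := α) (ps := ps) (ρ := ρ) hgpr hgst
  set I := interference α ps ρ gpr gst X om G with hI_def
  have hH := h.measurable_H
  have hind : IndepFun I H P := by
    have hφ : Measurable fun p : (ℕ → ℂ) × (ℕ → ℝ) × (ℕ → ℝ) ↦ ∑' i, ENNReal.ofReal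
        (if receivedPower α ps gpr gst (p.1 i) (p.2.1 i) (p.2.2 i) < ρ
          then receivedPower α ps gpr gst (p.1 i) (p.2.1 i) (p.2.2 i) else 0) := by
      refine Measurable.tsum fun i ↦ ?_
      exact (measurable_activePower hgpr hgst).comp (f := fun p : (ℕ → ℂ) × (ℕ → ℝ) × (ℕ → ℝ) ↦
        ((p.1 i, p.2.1 i), p.2.2 i)) (by fun_prop)
    exact h.indep_X_om_G_H.comp hφ measurable_id
  have hmap := (indepFun_iff_map_prod_eq_prod_map_map hI.aemeasurable hH.aemeasurable).1 hind
  rw [h.law_H.map_eq] at hmap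
  have hIp : IsProbabilityMeasure (P.map I) := Measure.isProbabilityMeasure_map hI.aemeasurable
  set D : Set (ℝ≥0∞ × ℝ) := {p | ENNReal.ofReal τ * (ENNReal.ofReal σ2 + p.1) <
    ENNReal.ofReal (p.2 * c)} with hD_def
  have hD : MeasurableSet D := measurableSet_lt (by fun_prop) (by fun_prop)
  -- Finiteness is essential at `τ = 0`: infinite interference gives SINR `0`, yet `0 * ∞ = 0` would
  -- satisfy the product inequality whenever `H > 0`.
  have hset : {w | ENNReal.ofReal τ < primarySINR α rp pp ps σ2 ρ gpt gpr gst X om G H w} =ᵐ[P]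
      (fun w ↦ (I w, H w)) ⁻¹' D := by
    filter_upwards [hfin] with w hw
    refine propext ?_
    change ENNReal.ofReal τ < ENNReal.ofReal (H w * pp * gpt 0 * gpr 0 * rp ^ (-α)) /
      (ENNReal.ofReal σ2 + I w) ↔ ENNReal.ofReal τ * (ENNReal.ofReal σ2 + I w) <
        ENNReal.ofReal (H w * c)
    rw [show H w * pp * gpt 0 * gpr 0 * rp ^ (-α) = H w * c by rw [hc_def]; ring]
    have hne : ENNReal.ofReal σ2 + I w ≠ ∞ := ENNReal.add_ne_top.2 ⟨ENNReal.ofReal_ne_top, hw⟩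
    by_cases h0 : ENNReal.ofReal σ2 + I w = 0
    -- Without noise and interference the quotient is `0/0 = 0` or `∞`, and both agree with the
    -- product form.
    · by_cases hn : ENNReal.ofReal (H w * c) = 0
      · simp [h0, hn]
      · simp [h0, ENNReal.div_zero hn, pos_iff_ne_zero, hn]
    · exact ENNReal.lt_div_iff_mul_lt (.inl h0) (.inl hne)
  rw [measure_congr hset, ← Measure.map_apply (hI.prodMk hH) hD, hmap, Measure.prod_apply hD,
    lintegral_map (measurable_measure_prodMk_left hD) hI]
  refine lintegral_congr_ae ?_
  filter_upwards [hfin] with w hw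
  have hne : ENNReal.ofReal σ2 + I w ≠ ∞ := ENNReal.add_ne_top.2 ⟨ENNReal.ofReal_ne_top, hw⟩
  obtain ⟨y, hy0, hy⟩ : ∃ y : ℝ, 0 ≤ y ∧ ENNReal.ofReal σ2 + I w = ENNReal.ofReal y :=
    ⟨_, ENNReal.toReal_nonneg, (ENNReal.ofReal_toReal hne).symm⟩
  have hpre : Prod.mk (I w) ⁻¹' D = Set.Ioi (τ / c * y) := by
    ext t
    simp only [hD_def, Set.mem_preimage, Set.mem_ofPred_eq, Set.mem_Ioi, hy]
    rw [← ENNReal.ofReal_mul hτ, ENNReal.ofReal_lt_ofReal_iff_of_nonneg (by positivity),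
      div_mul_eq_mul_div, div_lt_iff₀ hc]
  rw [hpre, hy, expMeasure_Ioi (by positivity), ← ENNReal.ofReal_mul (by positivity),
    expNeg_ofReal (by positivity)]

/-- The primary coverage for sectorized beams. -/
theorem IsNetwork.primaryCoverage_sectorBeam (h : IsNetwork P lam X om G H)
    {rp pp σ2 τ : ℝ} (hα : 2 < α) (hlam : 0 < lam) (hrp : 0 < rp) (hpp : 0 < pp) (hps : 0 < ps)
    (hσ2 : 0 ≤ σ2) (hρ : 0 < ρ) (hτ : 0 ≤ τ) {φpt apt bpt φpr apr bpr φst ast bst : ℝ}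
    (hφpt : 0 ≤ φpt ∧ φpt ≤ 2 * Real.pi) (hapt : 0 < apt)
    (hφpr : 0 ≤ φpr ∧ φpr ≤ 2 * Real.pi) (hapr : 0 < apr) (hbpr : 0 ≤ bpr)
    (hφst : 0 ≤ φst ∧ φst ≤ 2 * Real.pi) (hast : 0 < ast) (hbst : 0 ≤ bst) :
    primaryCoverage P α rp pp ps σ2 ρ τ (sectorBeam φpt apt bpt) (sectorBeam φpr apr bpr)
        (sectorBeam φst ast bst) X om G H =
      coverageFormula α lam ps σ2 ρ τ (ρ * rp ^ α / (pp * apt * apr))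
        (2 * Real.pi * beamMean φpr (apr ^ (2 / α)) (bpr ^ (2 / α)) *
          beamMean φst (ast ^ (2 / α)) (bst ^ (2 / α))) := by
  have hα0 : 0 < α := by linarith
  have hpi := Real.pi_pos
  have hgpr := measurable_sectorBeam hφpr apr bpr
  have hgst := measurable_sectorBeam hφst ast bst
  have hgpr0 := sectorBeam_nonneg hapr.le hbpr φpr
  have hgst0 := sectorBeam_nonneg hast.le hbst φst
  have hdir := lintegral_directivity_sectorBeam hφpr hφst hapr.le hbpr hast.le hbst (2 / α)
  have hfin := h.ae_interference_ne_top (ρ := ρ) hα hps.le hρ hgpr hgst hgpr0 hgst0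
    (hdir ▸ ENNReal.ofReal_ne_top)
  have hpt : sectorBeam φpt apt bpt 0 = apt := sectorBeam_zero hφpt.1 _ _
  have hpr : sectorBeam φpr apr bpr 0 = apr := sectorBeam_zero hφpr.1 _ _
  have hcov := h.measure_lt_primarySINR (σ2 := σ2) (rp := rp) (pp := pp)
    (gpt := sectorBeam φpt apt bpt) hτ (by rw [hpt, hpr]; positivity) hgpr hgst hfin
  rw [hpt, hpr] at hcov
  set n3 := 2 * Real.pi * beamMean φpr (apr ^ (2 / α)) (bpr ^ (2 / α)) *
          beamMean φst (ast ^ (2 / α)) (bst ^ (2 / α)) with hn3_def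
  have hn3 : 0 ≤ n3 := mul_nonneg (mul_nonneg (by positivity)
    (beamMean_nonneg hφpr (by positivity) (by positivity)))
    (beamMean_nonneg hφst (by positivity) (by positivity))
  set κ := ρ * rp ^ α / (pp * apt * apr) with hκ_def
  set s := τ / (pp * apt * apr * rp ^ (-α)) with hs_def
  have hs : 0 ≤ s := by positivity
  have hκ : 0 ≤ κ := by positivity
  -- This identity turns the Laplace variable `s` into the normalized threshold `κ_p τ` of the
  -- formula.
  have hsρ : s * ρ = κ * τ := by
    have : rp ^ α ≠ 0 := (Real.rpow_pos_of_pos hrp _).ne'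
    rw [hs_def, hκ_def, Real.rpow_neg hrp.le]
    field_simp
  obtain ⟨hK, hKeq⟩ := lintegral_one_sub_exp_mul_rpow_Ioo hα hs hρ
  have hL := h.lintegral_expNeg_mul_interference (ρ := ρ) hα0 hps.le hgpr hgst hgpr0 hgst0 hs
  rw [hdir] at hL
  set K := ∫⁻ t in Set.Ioo 0 ρ, ENNReal.ofReal ((1 - Real.exp (-(s * t))) * t ^ (-1 - 2 / α))
  have hΓ : 0 < Real.Gamma (1 + 2 / α) := Real.Gamma_pos_of_pos (by positivity)
  simp_rw [mul_add, expNeg_add] at hcov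
  rw [lintegral_const_mul' _ _ (expNeg_ne_top _), hL, ← ENNReal.ofReal_toReal hK,
    ← ENNReal.ofReal_mul (by positivity), ← ENNReal.ofReal_mul (by positivity),
    ← ENNReal.ofReal_mul (by positivity), ← ENNReal.ofReal_mul (by positivity),
    expNeg_ofReal (by positivity), expNeg_ofReal (by positivity),
    ← ENNReal.ofReal_mul (by positivity), ← Real.exp_add] at hcov
  rw [primaryCoverage, measureReal_def, hcov, ENNReal.toReal_ofReal (Real.exp_pos _).le,
    coverageFormula]
  congr 1
  have h1 : σ2 * κ * τ / ρ = s * σ2 := by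
    rw [mul_assoc, ← hsρ]; field_simp
  rw [h1, ← Real.mul_rpow hκ hτ, ← hsρ, sub_eq_add_neg]
  congr 1
  rw [neg_inj]
  calc lam * (ps ^ (2 / α) / α * Real.Gamma (1 + 2 / α) * n3 * K.toReal)
      = lam * ps ^ (2 / α) / α * n3 * (Real.Gamma (1 + 2 / α) * K.toReal) := by ring
    _ = _ := by
      rw [hKeq, Real.rpow_neg hρ.le]
      ring

end CognitiveNetwork

theorem corollary4 {Ω : Type*} [MeasurableSpace Ω] (P : Measure Ω) [IsProbabilityMeasure P]
    -- path-loss exponent, density of secondary transmitters, length of the primary link,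
    -- transmit powers, noise power, transmit-restriction threshold, SINR threshold
    (α lam rp pp ps σ2 ρ τ : ℝ)
    (hα : 2 < α) (hlam : 0 < lam) (hrp : 0 < rp) (hpp : 0 < pp) (hps : 0 < ps)
    (hσ2 : 0 ≤ σ2) (hρ : 0 < ρ) (hτ : 0 ≤ τ)
    -- beamwidths, main lobe gains and side lobe gains of the primary transmitter,
    -- the primary receiver and the secondary transmitters
    (φpt apt bpt φpr apr bpr φst ast bst : ℝ)
    (hφpt : 0 ≤ φpt ∧ φpt ≤ 2 * Real.pi) (hapt : 0 < apt) (hbpt : 0 ≤ bpt)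
    (hφpr : 0 ≤ φpr ∧ φpr ≤ 2 * Real.pi) (hapr : 0 < apr) (hbpr : 0 ≤ bpr)
    (hφst : 0 ≤ φst ∧ φst ≤ 2 * Real.pi) (hast : 0 < ast) (hbst : 0 ≤ bst)
    (X : ℕ → Ω → ℂ) (om G : ℕ → Ω → ℝ) (H : Ω → ℝ)
    (hnet : CognitiveNetwork.IsNetwork P lam X om G H) :
    -- the average secondary directivity for sectorized beams
    CognitiveNetwork.nThree α (CognitiveNetwork.sectorBeam φpr apr bpr)
        (CognitiveNetwork.sectorBeam φst ast bst) =
      2 * Real.pi *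
        (CognitiveNetwork.mainLobeProb φpr * apr ^ (2 / α) +
          (1 - CognitiveNetwork.mainLobeProb φpr) * bpr ^ (2 / α)) *
        (CognitiveNetwork.mainLobeProb φst * ast ^ (2 / α) +
          (1 - CognitiveNetwork.mainLobeProb φst) * bst ^ (2 / α)) ∧
    -- the primary coverage for sectorized beams
    CognitiveNetwork.primaryCoverage P α rp pp ps σ2 ρ τ
        (CognitiveNetwork.sectorBeam φpt apt bpt) (CognitiveNetwork.sectorBeam φpr apr bpr)
        (CognitiveNetwork.sectorBeam φst ast bst) X om G H =
      CognitiveNetwork.coverageFormula α lam ps σ2 ρ τ (ρ * rp ^ α / (pp * apt * apr))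
        (2 * Real.pi *
          (CognitiveNetwork.mainLobeProb φpr * apr ^ (2 / α) +
            (1 - CognitiveNetwork.mainLobeProb φpr) * bpr ^ (2 / α)) *
          (CognitiveNetwork.mainLobeProb φst * ast ^ (2 / α) +
            (1 - CognitiveNetwork.mainLobeProb φst) * bst ^ (2 / α))) ∧
    -- the primary coverage for ideal beams
    (bpr = 0 → bst = 0 →
      CognitiveNetwork.primaryCoverage P α rp pp ps σ2 ρ τ
          (CognitiveNetwork.sectorBeam φpt apt bpt) (CognitiveNetwork.sectorBeam φpr apr bpr)
          (CognitiveNetwork.sectorBeam φst ast bst) X om G H =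
        CognitiveNetwork.coverageFormula α lam ps σ2 ρ τ (ρ * rp ^ α / (pp * apt * apr))
          (2 * Real.pi * CognitiveNetwork.mainLobeProb φpr * CognitiveNetwork.mainLobeProb φst *
            (apr * ast) ^ (2 / α))) := by
  have hcov := hnet.primaryCoverage_sectorBeam hα hlam hrp hpp hps hσ2 hρ hτ (bpt := bpt) hφpt hapt
    hφpr hapr hbpr hφst hast hbst
  refine ⟨CognitiveNetwork.nThree_sectorBeam hφpr hφst hapr.le hbpr hast.le hbst α, hcov, ?_⟩
  rintro rfl rfl
  rw [hcov]
  congr 1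
  have hδ : 2 / α ≠ 0 := by positivity
  rw [CognitiveNetwork.beamMean, CognitiveNetwork.beamMean, Real.zero_rpow hδ,
    Real.mul_rpow hapr.le hast.le]
  ring
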